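/- Let $\mathcal{L}=\mathrm{Der}\,\mathbb{C}[t_1^{\pm1},t_2^{\pm1}]$, and for $\alpha\in\mathbb{Z}^2$ and $i\in\{1,2\}$ put $d_i(\alpha)=t^\alpha\bigl(t_i\frac{\partial}{\partial t_i}\bigr)$. Order $\mathbb{Z}^2$ lexicographically, and let $$\mathcal{L}^+=\bigoplus_{\alpha>0}\bigl(\mathbb{C}d_1(\alpha)\oplus\mathbb{C}d_2(\alpha)\bigr),\qquad \mathfrak{b}^-=\bigoplus_{\alpha\le 0}\bigl(\mathbb{C}d_1(\alpha)\oplus\mathbb{C}d_2(\alpha)\bigr),\qquad z=d_1(0),\qquad \varepsilon_2=(0,1).$$ Let $\psi:\mathcal{L}^+\to\mathbb{C}$ be a Lie algebra homomorphism that is nonsingular, that is, $\psi(d_1(\varepsilon_2))$, $\psi(d_2(\varepsilon_2))$ and $\psi(d_2(2\varepsilon_2))$ are all nonzero. Let $\mathbb{C}_\psi$ be the one-dimensional $\mathcal{L}^+$-module on which $x\in\mathcal{L}^+$ acts by $\psi(x)$, let $W_\psi=U(\mathcal{L})\otimes_{U(\mathcal{L}^+)}\mathbb{C}_\psi$ be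 the universal Whittaker module of type $\psi$, and let $w=1\otimes1$. For an ideal $I$ of the polynomial ring $\mathbb{C}[z]$ let $M(I)$ be the submodule of $W_\psi$ generated by $Iw$. Theorem 4.2. For every submodule $M$ of $W_\psi$ there is $g\in\mathbb{C}[z]$ with $M=U(\mathfrak{b}^-)g(z)w$. Moreover $M(\mathbb{C}[z]g)=U(\mathfrak{b}^-)g(z)w$ for every $g\in\mathbb{C}[z]$; the map $I\mapsto M(I)$ is a bijection from the set of ideals of $\mathbb{C}[z]$ onto the set of submodules of $W_\psi$, and it restricts to a bijection from the set of maximal ideals of $\mathbb{C}[z]$ onto the set of maximal submodules of $W_\psi$. -/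

import Mathlib

open Polynomial TensorProduct

attribute [local instance 100] LieRing.ofAssociativeRing

noncomputable section

namespace TorusWhittaker

/-- The group of exponents `ℤ²`. -/
abbrev Exponent : Type := Fin 2 → ℤ

/-- The Laurent polynomial ring `ℂ[t₁^{±1}, t₂^{±1}]`, as the group algebra of `ℤ²`; the monomial
`t^α` is `AddMonoidAlgebra.single α 1`. -/
abbrev Laurent : Type := AddMonoidAlgebra ℂ Exponent

/-- The Lie algebra `ℒ = Der ℂ[t₁^{±1}, t₂^{±1}]` with the commutator bracket. -/
abbrev DerL : Type := Derivation ℂ Laurent Laurent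

/-- The linear map `t^β ↦ β i • t^β` on Laurent polynomials. -/
def eulerLinear (i : Fin 2) : Laurent →ₗ[ℂ] Laurent where
  toFun f := ∑ β ∈ f.coeff.support, AddMonoidAlgebra.single β ((β i : ℂ) * f.coeff β)
  map_add' f g := by
    have key : ∀ h : Laurent,
        ∑ β ∈ h.coeff.support, (AddMonoidAlgebra.single β ((β i : ℂ) * h.coeff β) : Laurent) =
        h.coeff.sum fun β c => AddMonoidAlgebra.single β ((β i : ℂ) * c) := fun _ => rfl
    rw [key, key, key, AddMonoidAlgebra.coeff_add]
    exact Finsupp.sum_add_index' (by simp) (by simp [mul_add])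
  map_smul' c f := by
    have key : ∀ h : Laurent,
        ∑ β ∈ h.coeff.support, (AddMonoidAlgebra.single β ((β i : ℂ) * h.coeff β) : Laurent) =
        h.coeff.sum fun β c => AddMonoidAlgebra.single β ((β i : ℂ) * c) := fun _ => rfl
    rw [key, key, AddMonoidAlgebra.coeff_smul, Finsupp.sum_smul_index' (by simp),
      Finsupp.smul_sum]
    refine Finset.sum_congr rfl fun β _ => ?_
    simp [mul_left_comm]

theorem eulerLinear_single (i : Fin 2) (β : Exponent) (c : ℂ) :
    eulerLinear i (AddMonoidAlgebra.single β c) = AddMonoidAlgebra.single β ((β i : ℂ) * c) := by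
  change (Finsupp.single β c).sum
    (fun γ b => (AddMonoidAlgebra.single γ ((γ i : ℂ) * b) : Laurent)) = _
  rw [Finsupp.sum_single_index (by simp)]

/-- The degree derivation `t_i ∂/∂t_i`. -/
def euler (i : Fin 2) : DerL :=
  Derivation.mk' (eulerLinear i) (by
    intro f g
    induction f using AddMonoidAlgebra.induction_linear with
    | zero => simp
    | add f₁ f₂ h₁ h₂ => simp only [add_mul, map_add, h₁, h₂, smul_add, add_smul]; abel
    | single α a =>
      induction g using AddMonoidAlgebra.induction_linear with
      | zero => simp
      | add g₁ g₂ h₁ h₂ => simp only [mul_add, map_add, h₁, h₂, smul_add, add_smul]; abel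
      | single β b =>
        simp only [AddMonoidAlgebra.single_mul_single, eulerLinear_single, smul_eq_mul]
        rw [add_comm β α, ← AddMonoidAlgebra.single_add]
        congr 1
        push_cast [Pi.add_apply]
        ring)

/-- The derivation `d_i(α) = t^α (t_i ∂/∂t_i)`. -/
def d (i : Fin 2) (α : Exponent) : DerL :=
  (AddMonoidAlgebra.single α (1 : ℂ) : Laurent) • euler i

theorem d_apply_single (i : Fin 2) (α β : Exponent) (c : ℂ) :
    d i α (AddMonoidAlgebra.single β c) = AddMonoidAlgebra.single (α + β) ((β i : ℂ) * c) := by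
  change (AddMonoidAlgebra.single α (1 : ℂ) : Laurent) *
    eulerLinear i (AddMonoidAlgebra.single β c) = _
  rw [eulerLinear_single, AddMonoidAlgebra.single_mul_single, one_mul]

theorem bracket_d (i j : Fin 2) (α β : Exponent) :
    ⁅d i α, d j β⁆ = (β i : ℂ) • d j (α + β) - (α j : ℂ) • d i (α + β) := by
  refine Derivation.ext fun f => ?_
  induction f using AddMonoidAlgebra.induction_linear with
  | zero => simp only [map_zero]
  | add f₁ f₂ h₁ h₂ => rw [map_add, map_add, h₁, h₂]
  | single γ c =>
    rw [Derivation.commutator_apply, Derivation.sub_apply, Derivation.smul_apply,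
      Derivation.smul_apply]
    simp only [d_apply_single, AddMonoidAlgebra.smul_single]
    rw [← add_assoc, ← add_assoc, add_comm β α, ← AddMonoidAlgebra.single_sub,
      ← AddMonoidAlgebra.single_sub]
    congr 1
    simp only [Pi.add_apply, smul_eq_mul]
    push_cast
    ring

/-- For a set `S` of exponents, the subspace `⊕_{α ∈ S} ℒ_α` of `ℒ`, where `ℒ_α` is spanned by
`d_1(α)` and `d_2(α)`. -/
def gradedSpan (S : Set Exponent) : Submodule ℂ DerL :=
  Submodule.span ℂ {x : DerL | ∃ i : Fin 2, ∃ α ∈ S, x = d i α}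

/-- If `S` is closed under addition, `⊕_{α ∈ S} ℒ_α` is a Lie subalgebra of `ℒ`. -/
def gradedPart (S : Set Exponent) (hS : ∀ α ∈ S, ∀ β ∈ S, α + β ∈ S) : LieSubalgebra ℂ DerL where
  __ := gradedSpan S
  lie_mem' := by
    intro x y hx hy
    refine SetLike.mem_coe (p := gradedSpan S) |>.mpr ?_
    induction hx using Submodule.span_induction with
    | zero => rw [zero_lie]; exact Submodule.zero_mem _
    | add x₁ x₂ _ _ h₁ h₂ => rw [add_lie]; exact Submodule.add_mem _ h₁ h₂
    | smul c x _ h => rw [smul_lie]; exact Submodule.smul_mem _ _ h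
    | mem x hx =>
      induction hy using Submodule.span_induction with
      | zero => rw [lie_zero]; exact Submodule.zero_mem _
      | add y₁ y₂ _ _ h₁ h₂ => rw [lie_add]; exact Submodule.add_mem _ h₁ h₂
      | smul c y _ h => rw [lie_smul]; exact Submodule.smul_mem _ _ h
      | mem y hy =>
        obtain ⟨i, α, hα, rfl⟩ := hx
        obtain ⟨j, β, hβ, rfl⟩ := hy
        rw [bracket_d]
        exact Submodule.sub_mem _
          (Submodule.smul_mem _ _ (Submodule.subset_span ⟨j, _, hS α hα β hβ, rfl⟩))
          (Submodule.smul_mem _ _ (Submodule.subset_span ⟨i, _, hS α hα β hβ, rfl⟩))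

/-- `ℒ⁺ = ⊕_{α > 0} ℒ_α`, for the lexicographic order on `ℤ²`. -/
def LPlus : LieSubalgebra ℂ DerL :=
  gradedPart {α | 0 < toLex α} fun _ hα _ hβ => add_pos (α := Lex Exponent) hα hβ

/-- `𝔟⁻ = ℒ⁻ ⊕ 𝔥 = ⊕_{α ≤ 0} ℒ_α`, for the lexicographic order on `ℤ²`. -/
def bMinus : LieSubalgebra ℂ DerL :=
  gradedPart {α | toLex α ≤ 0} fun _ hα _ hβ => add_nonpos (α := Lex Exponent) hα hβ

/-- `d_i(α)` as an element of `ℒ⁺`, for `α > 0`. -/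
def dPlus (i : Fin 2) (α : Exponent) (hα : 0 < toLex α) : LPlus :=
  ⟨d i α, (Submodule.subset_span ⟨i, α, hα, rfl⟩ : d i α ∈ gradedSpan {α | 0 < toLex α})⟩

/-- The exponent `k ε₂ = (0, k)`. -/
def kEps (k : ℤ) : Exponent := ![0, k]

theorem kEps_pos {k : ℤ} (hk : 0 < k) : 0 < toLex (kEps k) := by
  refine ⟨1, fun j hj => ?_, ?_⟩
  · have : j = 0 := by omega
    subst this
    rfl
  · exact hk

/-- A homomorphism `ψ : ℒ⁺ → ℂ` is nonsingular if it is nonzero at each of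
`d_1(ε₂)`, `d_2(ε₂)` and `d_2(2ε₂)`. -/
def Nonsingular (ψ : LPlus →ₗ⁅ℂ⁆ ℂ) : Prop :=
  ψ (dPlus 0 (kEps 1) (kEps_pos one_pos)) ≠ 0 ∧
  ψ (dPlus 1 (kEps 1) (kEps_pos one_pos)) ≠ 0 ∧
  ψ (dPlus 1 (kEps 2) (kEps_pos two_pos)) ≠ 0

/-- The universal enveloping algebra `U(ℒ)`. -/
abbrev UL : Type := UniversalEnvelopingAlgebra ℂ DerL

/-- For a Lie subalgebra `𝔨` of `ℒ`, the map `U(𝔨) → U(ℒ)` induced by the inclusion. -/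
def envIncl (K : LieSubalgebra ℂ DerL) : UniversalEnvelopingAlgebra ℂ K →ₐ[ℂ] UL :=
  UniversalEnvelopingAlgebra.lift ℂ ((UniversalEnvelopingAlgebra.ι ℂ).comp K.incl)

/-- The relations `u s ⊗ c = u ⊗ s c` (`s ∈ U(ℒ⁺)`) defining the tensor product
`U(ℒ) ⊗_{U(ℒ⁺)} ℂ_ψ` as a quotient of `U(ℒ) ⊗_ℂ ℂ`. Here `s ∈ U(ℒ⁺)` acts on `ℂ_ψ = ℂ` through the
algebra homomorphism `U(ℒ⁺) → ℂ` that extends `ψ`. -/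
def balancing (ψ : LPlus →ₗ⁅ℂ⁆ ℂ) : Submodule UL (UL ⊗[ℂ] ℂ) :=
  Submodule.span UL {x | ∃ (u : UL) (s : UniversalEnvelopingAlgebra ℂ LPlus) (c : ℂ),
    x = (u * envIncl LPlus s) ⊗ₜ[ℂ] c - u ⊗ₜ[ℂ] (UniversalEnvelopingAlgebra.lift ℂ ψ s * c)}

/-- The universal Whittaker module `W_ψ = U(ℒ) ⊗_{U(ℒ⁺)} ℂ_ψ`, a left `U(ℒ)`-module. -/
abbrev W (ψ : LPlus →ₗ⁅ℂ⁆ ℂ) : Type := (UL ⊗[ℂ] ℂ) ⧸ balancing ψ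

/-- The cyclic Whittaker vector `w = 1 ⊗ 1` of `W_ψ`. -/
def w (ψ : LPlus →ₗ⁅ℂ⁆ ℂ) : W ψ := (balancing ψ).mkQ (1 ⊗ₜ[ℂ] 1)

/-- `f(z) ∈ U(ℒ)` for a polynomial `f`, where `z = d_1(0)`. -/
def evalZ (f : ℂ[X]) : UL := aeval (UniversalEnvelopingAlgebra.ι ℂ (d 0 0)) f

/-- The submodule `M(I)` of `W_ψ` generated by `I w`, for an ideal `I` of `ℂ[z]`. -/
def idealSubmodule (ψ : LPlus →ₗ⁅ℂ⁆ ℂ) (I : Ideal ℂ[X]) : Submodule UL (W ψ) :=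
  Submodule.span UL {v | ∃ f ∈ I, v = evalZ f • w ψ}

/-- The subset `U(𝔟⁻) v` of `W_ψ`. -/
def bMinusOrbit (ψ : LPlus →ₗ⁅ℂ⁆ ℂ) (v : W ψ) : Set (W ψ) :=
  {x | ∃ u : UniversalEnvelopingAlgebra ℂ bMinus, x = envIncl bMinus u • v}

end TorusWhittaker

end

/-!
# Submodules of the universal Whittaker module of the torus

Write `e k` for the generators `d i α` of `U(ℒ)`, and call a letter `k` negative if it belongs to
`𝔟⁻` and differs from `z`. If `Q` is a `z`-stable space of Whittaker vectors of type `ψ` in any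
`ℒ`-module `V`, then the words in the negative letters, one arrangement for each multiset of
letters, generate `V` freely from `Q`: an expansion `∑ m, word e (arr m) • q m` with coefficients
`q m ∈ Q` vanishes only if all its coefficients do (`eq_zero_of_expand_eq_zero`). Such expansions
form a submodule (`smul_mem_wordSpan`), so they exhaust `W_ψ` when `Q = ℂ[z] w`. Apply the freeness
to the image of `ℂ[z] w` in `W_ψ / M`: an element of `M` is an expansion that vanishes modulo `M`,
so its coefficients lie in `M`. Thus `M` is generated by its vectors `f(z) w`, and the
corresponding `f` form an ideal of `ℂ[z]`, which is principal (`idealSubmodule_idealOf`).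

Freeness comes from a leading term computation. For a grading of `ℒ` and a letter `x` of `ℒ⁺`, the
operator `x - ψ(x)` removes from a word a letter `j` for which `⁅x, j⁆` has the extreme degree where
`ψ` does not vanish, up to terms of lower weight or length (`TriangularData.pos_smul_word`). On
leading terms it is therefore the derivation `∑ j, ψ(⁅x, j⁆) ∂ⱼ`, and an induction on the length of
the leading terms applies as soon as the pairing `ψ(⁅x, j⁆)` is nondegenerate. For the grading by
`ℤ²` this holds at the letters `d i α` with `α 0 < 0`, because `ψ(d₂(2ε₂)) ≠ 0`. The other letters
span a subalgebra with a second grading, for which it holds at all letters, because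
`ψ(d₁(ε₂)) ≠ 0`.

It remains to recover `I` from `M(I)`, that is, to see that `W_ψ` is large. This is an instance of
the Poincaré–Birkhoff–Witt theorem. Its independence part follows from an action of `ℒ` by
derivations on a polynomial ring with coordinates at a point that are dual to the `d i α`
(`linearIndependent_word`). It yields a functional on `U(ℒ)` with values in `ℂ[z]` that descends to
`W_ψ`, sends `f(z) w` to `f`, and maps `M(I)` into `I` (`idealOf_idealSubmodule`).
-/

namespace TorusWhittaker

/-! ### Words in the generators of an algebra -/

section Words

variable {𝕜 U V ι Γ : Type*} [Field 𝕜] [Ring U] [AddCommGroup V] [Module 𝕜 V]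
  [Module U V]

/-- The product `e i₁ * ⋯ * e iₙ` attached to a word `i₁ ⋯ iₙ`. -/
def word (e : ι → U) (l : List ι) : U := (l.map e).prod

@[simp] theorem word_nil (e : ι → U) : word e [] = 1 := rfl

@[simp] theorem word_cons (e : ι → U) (i : ι) (l : List ι) : word e (i :: l) = e i * word e l := by
  simp [word]

theorem word_append (e : ι → U) (l l' : List ι) : word e (l ++ l') = word e l * word e l' := by
  simp [word]

/-- The span of the vectors `word e l • q`, for words `l` satisfying `P` and vectors `q ∈ Q`. -/
def wordSpan (e : ι → U) (Q : Submodule 𝕜 V) (P : List ι → Prop) : Submodule 𝕜 V :=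
  Submodule.span 𝕜 {v | ∃ l, P l ∧ ∃ q ∈ Q, v = word e l • q}

theorem word_smul_mem (e : ι → U) {Q : Submodule 𝕜 V} {P : List ι → Prop} {l : List ι} {q : V}
    (hl : P l) (hq : q ∈ Q) : word e l • q ∈ wordSpan e Q P :=
  Submodule.subset_span ⟨l, hl, q, hq, rfl⟩

theorem wordSpan_le {e : ι → U} {Q : Submodule 𝕜 V} {P : List ι → Prop} {S : Submodule 𝕜 V}
    (h : ∀ l, P l → ∀ q ∈ Q, word e l • q ∈ S) : wordSpan e Q P ≤ S := by
  refine Submodule.span_le.mpr ?_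
  rintro _ ⟨l, hl, q, hq, rfl⟩
  exact h l hl q hq

theorem wordSpan_mono {e : ι → U} {Q : Submodule 𝕜 V} {P P' : List ι → Prop}
    (h : ∀ l, P l → P' l) : wordSpan e Q P ≤ wordSpan e Q P' :=
  wordSpan_le fun l hl _ hq => word_smul_mem e (h l hl) hq

variable [Algebra 𝕜 U] [IsScalarTower 𝕜 U V]

theorem smul_mem_of_wordSpan {e : ι → U} {Q : Submodule 𝕜 V} {P : List ι → Prop}
    {S : Submodule 𝕜 V} (u : U) (h : ∀ l, P l → ∀ q ∈ Q, u • word e l • q ∈ S) {v : V}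
    (hv : v ∈ wordSpan e Q P) : u • v ∈ S := by
  induction hv using Submodule.span_induction with
  | zero => simp
  | add v₁ v₂ _ _ h₁ h₂ => rw [smul_add]; exact S.add_mem h₁ h₂
  | smul c v _ h => rw [smul_comm]; exact S.smul_mem c h
  | mem v hv =>
    obtain ⟨l, hl, q, hq, rfl⟩ := hv
    exact h l hl q hq

/-- If `x` lies in the span of the `e k` with `k ∈ S`, then `x • v` lies in every subspace that
contains all the `e k • v`. -/
theorem smul_mem_of_mem_span {e : ι → U} {S : Set ι} {x : U} (hx : x ∈ Submodule.span 𝕜 (e '' S))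
    {T : Submodule 𝕜 V} {v : V} (h : ∀ k ∈ S, e k • v ∈ T) : x • v ∈ T := by
  induction hx using Submodule.span_induction with
  | zero => simp
  | add v₁ v₂ _ _ h₁ h₂ => rw [add_smul]; exact T.add_mem h₁ h₂
  | smul c v _ h => rw [smul_assoc]; exact T.smul_mem c h
  | mem v hv =>
    obtain ⟨k, hk, rfl⟩ := hv
    exact h k hk

/-- The weight of a word: the sum of the weights of its letters. -/
def wordWt [AddCommGroup Γ] (wt : ι → Γ) (m : Multiset ι) : Γ := (m.map wt).sum

@[simp] theorem wordWt_zero [AddCommGroup Γ] (wt : ι → Γ) : wordWt wt 0 = 0 := rfl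

@[simp] theorem wordWt_cons [AddCommGroup Γ] (wt : ι → Γ) (i : ι) (m : Multiset ι) :
    wordWt wt (i ::ₘ m) = wt i + wordWt wt m := by simp [wordWt]

theorem wordWt_erase [AddCommGroup Γ] [DecidableEq ι] (wt : ι → Γ) {i : ι} {m : Multiset ι}
    (h : i ∈ m) : wordWt wt (m.erase i) = wordWt wt m - wt i := by
  conv_rhs => rw [← Multiset.cons_erase h]
  simp

/-- Words in the letters `N` of weight `δ` and length less than `k`. -/
def IsShort [AddCommGroup Γ] (N : Set ι) (wt : ι → Γ) (δ : Γ) (k : ℕ) (l : List ι) : Prop :=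
  (∀ i ∈ l, i ∈ N) ∧ wordWt wt l = δ ∧ l.length < k

/-- The letters `N` are closed under commutators, compatibly with the weights. -/
def LieClosed [AddCommGroup Γ] (𝕜 : Type*) [Field 𝕜] [Algebra 𝕜 U] (e : ι → U) (N : Set ι)
    (wt : ι → Γ) : Prop :=
  ∀ i ∈ N, ∀ j ∈ N, e i * e j - e j * e i ∈
    Submodule.span 𝕜 (e '' {k | k ∈ N ∧ wt k = wt i + wt j})

variable [AddCommGroup Γ] {e : ι → U} {N : Set ι} {wt : ι → Γ} {Q : Submodule 𝕜 V}

/-- Permuting the letters of a word changes it only by shorter words of the same weight. -/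
theorem word_perm_sub_mem (hN : LieClosed 𝕜 e N wt) {l l' : List ι} (h : l.Perm l')
    (hl : ∀ i ∈ l, i ∈ N) {q : V} (hq : q ∈ Q) :
    word e l • q - word e l' • q ∈ wordSpan e Q (IsShort N wt (wordWt wt l) l.length) := by
  induction h with
  | nil => simp
  | cons i h ih =>
    rename_i l₁ l₂
    rw [word_cons, word_cons, mul_smul, mul_smul, ← smul_sub]
    refine smul_mem_of_wordSpan _ (fun l' hl' q' hq' => ?_) (ih fun i hi => hl i (by simp [hi]))
    rw [← mul_smul, ← word_cons]
    refine word_smul_mem e ⟨?_, ?_, ?_⟩ hq'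
    · intro j hj
      rcases List.mem_cons.mp hj with rfl | hj
      · exact hl _ (by simp)
      · exact hl'.1 j hj
    · simp [← Multiset.cons_coe, hl'.2.1]
    · simpa using hl'.2.2
  | swap i j l =>
    have : word e (j :: i :: l) • q - word e (i :: j :: l) • q =
        (e j * e i - e i * e j) • word e l • q := by
      simp only [word_cons, sub_smul, mul_smul]
    rw [this]
    refine smul_mem_of_mem_span (hN j (hl _ (by simp)) i (hl _ (by simp))) fun k hk => ?_
    rw [← mul_smul, ← word_cons]
    refine word_smul_mem e ⟨?_, ?_, ?_⟩ hq
    · intro j hj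
      rcases List.mem_cons.mp hj with rfl | hj
      · exact hk.1
      · exact hl j (by simp [hj])
    · simp [← Multiset.cons_coe, hk.2, add_assoc]
    · simp
  | trans h₁ h₂ ih₁ ih₂ =>
    rename_i l₁ l₂ l₃
    have h₃ := ih₂ fun i hi => hl i (h₁.mem_iff.mpr hi)
    rw [← Multiset.coe_eq_coe.mpr h₁, ← h₁.length_eq] at h₃
    simpa using Submodule.add_mem _ (ih₁ hl) h₃

variable (arr : Multiset ι → List ι) (harr : ∀ m, (arr m : Multiset ι) = m)

include harr in
/-- Every word is a combination of arranged words of the same weight that are not longer. -/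
theorem wordSpan_isShort_le_arranged (hN : LieClosed 𝕜 e N wt) (δ : Γ) (k : ℕ) :
    wordSpan e Q (IsShort N wt δ k) ≤
      wordSpan e Q fun l => IsShort N wt δ k l ∧ ∃ m, l = arr m := by
  induction k with
  | zero => exact wordSpan_le fun l hl => absurd hl.2.2 (by simp)
  | succ k ih =>
    refine wordSpan_le fun l hl q hq => ?_
    have hp : l.Perm (arr l) := by rw [← Multiset.coe_eq_coe, harr]
    have h₁ := word_perm_sub_mem hN hp hl.1 hq
    rw [← sub_add_cancel (word e l • q) (word e (arr l) • q)]
    refine Submodule.add_mem _ ?_ (word_smul_mem e ⟨⟨?_, ?_, ?_⟩, _, rfl⟩ hq)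
    · have h₂ : wordSpan e Q (IsShort N wt (wordWt wt l) l.length) ≤
          wordSpan e Q (IsShort N wt δ k) := wordSpan_mono fun l' hl' =>
        ⟨hl'.1, hl'.2.1.trans hl.2.1, hl'.2.2.trans_le (Nat.lt_succ_iff.mp hl.2.2)⟩
      exact wordSpan_mono (fun l' hl' => ⟨⟨hl'.1.1, hl'.1.2.1, hl'.1.2.2.trans k.lt_succ_self⟩,
        hl'.2⟩) (ih (h₂ h₁))
    · exact fun i hi => hl.1 i (hp.mem_iff.mpr hi)
    · rw [harr]; exact hl.2.1
    · rw [← hp.length_eq]; exact hl.2.2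

end Words

/-! ### Leading terms of the action on words -/

section Leading

theorem sum_map_sub_mem {M : Type*} [AddCommGroup M] {S : AddSubgroup M} {α : Type*}
    {m : Multiset α} {f g : α → M} (h : ∀ a ∈ m, f a - g a ∈ S) :
    (m.map f).sum - (m.map g).sum ∈ S := by
  rw [← Multiset.sum_map_sub]
  exact AddSubmonoid.multiset_sum_mem S.toAddSubmonoid _ (by
    intro x hx
    obtain ⟨a, ha, rfl⟩ := Multiset.mem_map.mp hx
    exact h a ha)

/-- A triangular decomposition with a character: letters `neg`, `z` and `pos`, realized in an
algebra `U` by `e`, with additive weights `wt`. The weights of the letters in `neg` are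
nonnegative, and the character `ψ` of the letters in `pos` vanishes below the weight `τ < 0`.
`pair x j` is the value of `ψ` at `⁅x, j⁆` if this commutator has weight `τ`, and zero otherwise. -/
structure TriangularData (𝕜 U ι Γ : Type*) [Field 𝕜] [Ring U] [Algebra 𝕜 U] [AddCommGroup Γ]
    [LinearOrder Γ] where
  /-- The elements of the algebra attached to the letters. -/
  e : ι → U
  /-- The lowering letters. -/
  neg : Set ι
  /-- The raising letters. -/
  pos : Set ι
  /-- The letter acting on the space of Whittaker vectors. -/
  z : ι
  /-- The weights of the letters. -/
  wt : ι → Γ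
  /-- The character of the raising letters. -/
  ψ : ι → 𝕜
  /-- The lowest weight where the character does not vanish. -/
  τ : Γ
  /-- The leading part of the pairing `(x, j) ↦ ψ ⁅x, j⁆`. -/
  pair : ι → ι → 𝕜
  τ_neg : τ < 0
  wt_nonneg : ∀ i ∈ neg, 0 ≤ wt i
  lt_wt_z : τ < wt z
  le_wt : ∀ k ∈ pos, ψ k ≠ 0 → τ ≤ wt k
  closed : LieClosed 𝕜 e neg wt
  lie_z : ∀ j ∈ neg, ∃ c : 𝕜, e z * e j - e j * e z = c • e j
  lie_pos : ∀ x ∈ pos, ∀ j ∈ neg, ∃ a : ι →₀ 𝕜,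
    e x * e j - e j * e x = ∑ k ∈ a.support, a k • e k ∧
    (∀ k ∈ a.support, (k ∈ neg ∨ k = z ∨ k ∈ pos) ∧ wt k = wt x + wt j) ∧
    pair x j = if wt x + wt j = τ then ∑ k ∈ a.support, a k * ψ k else 0

variable {𝕜 U V ι Γ : Type*} [Field 𝕜] [Ring U] [Algebra 𝕜 U] [AddCommGroup V] [Module 𝕜 V]
  [Module U V] [AddCommGroup Γ] [LinearOrder Γ]
  (T : TriangularData 𝕜 U ι Γ)

namespace TriangularData

/-- A space of Whittaker vectors: the raising letters act by the character, and the space is stable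
under `z`. -/
structure IsWhittaker (Q : Submodule 𝕜 V) : Prop where
  z_mem : ∀ q ∈ Q, T.e T.z • q ∈ Q
  pos_smul : ∀ k ∈ T.pos, ∀ q ∈ Q, T.e k • q = T.ψ k • q

/-- Words in the lowering letters of weight less than `δ`, or of weight `δ` and of length less than
`k - 1`. -/
def IsLow (δ : Γ) (k : ℕ) (l : List ι) : Prop :=
  (∀ i ∈ l, i ∈ T.neg) ∧ (wordWt T.wt l < δ ∨ wordWt T.wt l = δ ∧ l.length + 1 < k)

variable {T} {Q : Submodule 𝕜 V}

theorem IsLow.mono {δ δ' : Γ} {k k' : ℕ} (h : δ < δ' ∨ δ = δ' ∧ k ≤ k') {l : List ι}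
    (hl : T.IsLow δ k l) : T.IsLow δ' k' l := by
  refine ⟨hl.1, ?_⟩
  rcases h with h | ⟨rfl, h⟩
  · rcases hl.2 with h' | h'
    · exact Or.inl (h'.trans h)
    · exact Or.inl (h'.1.trans_lt h)
  · exact hl.2.imp_right fun h' => ⟨h'.1, h'.2.trans_le h⟩

theorem isShort_le_low {δ δ' : Γ} {k k' : ℕ} (h : δ < δ' ∨ δ = δ' ∧ k < k') :
    wordSpan T.e Q (IsShort T.neg T.wt δ k) ≤ wordSpan T.e Q (T.IsLow δ' k') := by
  refine wordSpan_mono fun l hl => ⟨hl.1, ?_⟩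
  rcases h with h | ⟨rfl, h⟩
  · exact Or.inl (hl.2.1.trans_lt h)
  · exact Or.inr ⟨hl.2.1, by have := hl.2.2; omega⟩

theorem wt_add_wt_of_pair_ne_zero {x j : ι} (hx : x ∈ T.pos) (hj : j ∈ T.neg)
    (h : T.pair x j ≠ 0) : T.wt x + T.wt j = T.τ := by
  obtain ⟨a, -, -, ha⟩ := T.lie_pos x hx j hj
  by_contra h'
  exact h (by rw [ha, if_neg h'])

theorem IsLow.cons [IsOrderedAddMonoid Γ] {δ : Γ} {k : ℕ} {l : List ι} (hl : T.IsLow δ k l)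
    {j : ι} (hj : j ∈ T.neg) : T.IsLow (T.wt j + δ) (k + 1) (j :: l) := by
  refine ⟨fun i hi => ?_, ?_⟩
  · rcases List.mem_cons.mp hi with rfl | hi
    · exact hj
    · exact hl.1 i hi
  · rw [← Multiset.cons_coe, wordWt_cons, List.length_cons]
    refine hl.2.imp (fun h => by gcongr) fun h => ⟨by rw [h.1], by omega⟩

variable [IsScalarTower 𝕜 U V]

theorem smul_mem_low [IsOrderedAddMonoid Γ] {δ : Γ} {k : ℕ} {j : ι} (hj : j ∈ T.neg) {v : V}
    (hv : v ∈ wordSpan T.e Q (T.IsLow δ k)) :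
    T.e j • v ∈ wordSpan T.e Q (T.IsLow (T.wt j + δ) (k + 1)) := by
  refine smul_mem_of_wordSpan _ (fun l hl q hq => ?_) hv
  rw [← mul_smul, ← word_cons]
  exact word_smul_mem _ (hl.cons hj) hq

/-- The letter `z` moves through a word in the lowering letters. -/
theorem z_smul_word (hQ : T.IsWhittaker Q) (l : List ι) (hl : ∀ i ∈ l, i ∈ T.neg) {q : V}
    (hq : q ∈ Q) : ∃ q' ∈ Q, T.e T.z • word T.e l • q = word T.e l • q' := by
  induction l with
  | nil => exact ⟨T.e T.z • q, hQ.z_mem q hq, by simp⟩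
  | cons j l ih =>
    obtain ⟨q', hq', h⟩ := ih fun i hi => hl i (by simp [hi])
    obtain ⟨c, hc⟩ := T.lie_z j (hl j (by simp))
    refine ⟨q' + c • q, Q.add_mem hq' (Q.smul_mem c hq), ?_⟩
    have hc' : T.e T.z * T.e j = T.e j * T.e T.z + c • T.e j := by rw [← hc]; abel
    have h₁ : T.e T.z • T.e j • word T.e l • q =
        T.e j • T.e T.z • word T.e l • q + c • T.e j • word T.e l • q := by
      rw [← mul_smul, hc', add_smul, mul_smul, smul_assoc]
    rw [word_cons, mul_smul, h₁, h, mul_smul, smul_add, smul_add, smul_comm (word T.e l) c,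
      smul_comm (T.e j) c]

variable [DecidableEq ι] {arr : Multiset ι → List ι} (harr : ∀ m, (arr m : Multiset ι) = m)

variable (T arr) in
/-- The leading part of the action of the raising letter `x` on `word e m • q`: each letter `j` of
`m` in turn is removed and replaced by the scalar `pair x j`. -/
def contraction (x : ι) (m : Multiset ι) (q : V) : V :=
  (m.map fun j => T.pair x j • word T.e (arr (m.erase j)) • q).sum

include harr in
theorem smul_contraction_sub_mem (x j : ι) (hx : x ∈ T.pos) (l : List ι)
    (hl : ∀ i ∈ j :: l, i ∈ T.neg) {q : V} (hq : q ∈ Q) :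
    T.e j • T.contraction arr x l q + T.pair x j • word T.e l • q
      - T.contraction arr x (j :: l : List ι) q ∈
      wordSpan T.e Q (T.IsLow (T.wt x + wordWt T.wt (j :: l : List ι) - T.τ) (l.length + 1)) := by
  have key : ∀ j' ∈ (j :: l), ∀ l' : List ι, (j' :: l').Perm (j :: l) →
      T.pair x j' • word T.e l' • q -
        T.pair x j' • word T.e (arr (((j :: l : List ι) : Multiset ι).erase j')) • q ∈
      wordSpan T.e Q (T.IsLow (T.wt x + wordWt T.wt (j :: l : List ι) - T.τ) (l.length + 1)) := by
    intro j' hj' l' hl'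
    rcases eq_or_ne (T.pair x j') 0 with h0 | h0
    · simp [h0]
    rw [← smul_sub]
    refine Submodule.smul_mem _ _ ?_
    have hm : ((j :: l : List ι) : Multiset ι) = j' ::ₘ (l' : Multiset ι) := by
      rw [Multiset.cons_coe, Multiset.coe_eq_coe]; exact hl'.symm
    have hp : l'.Perm (arr (((j :: l : List ι) : Multiset ι).erase j')) := by
      rw [← Multiset.coe_eq_coe, harr, hm, Multiset.erase_cons_head]
    have h1 := wt_add_wt_of_pair_ne_zero hx (hl j' hj') h0
    have h2 : l'.length = l.length := by simpa using hl'.length_eq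
    refine isShort_le_low (Or.inr ⟨?_, ?_⟩) (word_perm_sub_mem T.closed hp (fun i hi =>
      hl i (hl'.mem_iff.mp (by simp [hi]))) hq)
    · rw [hm, wordWt_cons, ← h1]; abel
    · omega
  have h1 : T.e j • T.contraction arr x l q =
      ((l : Multiset ι).map fun j' =>
        T.pair x j' • word T.e (j :: arr ((l : Multiset ι).erase j')) • q).sum := by
    rw [contraction, Multiset.smul_sum, Multiset.map_map]
    congr 1
    refine Multiset.map_congr rfl fun j' _ => ?_
    rw [Function.comp_apply, smul_comm, word_cons, mul_smul]
  have h2 : T.contraction arr x (j :: l : List ι) q =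
      T.pair x j • word T.e (arr (((j :: l : List ι) : Multiset ι).erase j)) • q +
      ((l : Multiset ι).map fun j' => T.pair x j' •
        word T.e (arr (((j :: l : List ι) : Multiset ι).erase j')) • q).sum := by
    rw [contraction, ← Multiset.cons_coe, Multiset.map_cons, Multiset.sum_cons]
  rw [h1, h2, add_comm (Multiset.sum _), add_sub_add_comm]
  refine Submodule.add_mem _ (key j (by simp) l (List.Perm.refl _)) ?_
  refine sum_map_sub_mem (S := (wordSpan T.e Q _).toAddSubgroup) fun j' hj' => ?_
  refine key j' (List.mem_cons_of_mem _ hj') _ ?_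
  rw [← Multiset.coe_eq_coe, ← Multiset.cons_coe, ← Multiset.cons_coe, harr, ← Multiset.cons_coe,
    Multiset.cons_swap, Multiset.cons_erase hj']

include harr in
/-- A raising letter `x` acts on `word e l • q`, up to its character and to lower terms, by
contraction. -/
theorem pos_smul_word [IsOrderedAddMonoid Γ] (hQ : T.IsWhittaker Q) (l : List ι)
    (hl : ∀ i ∈ l, i ∈ T.neg) {q : V} (hq : q ∈ Q) (x : ι) (hx : x ∈ T.pos) :
    T.e x • word T.e l • q - T.ψ x • word T.e l • q - T.contraction arr x l q ∈
      wordSpan T.e Q (T.IsLow (T.wt x + wordWt T.wt l - T.τ) l.length) := by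
  induction l generalizing x with
  | nil => simp [hQ.pos_smul x hx q hq, contraction]
  | cons j l ih =>
    have hj : j ∈ T.neg := hl j (by simp)
    have hl' : ∀ i ∈ l, i ∈ T.neg := fun i hi => hl i (by simp [hi])
    specialize ih hl'
    obtain ⟨a, ha, hak, hp⟩ := T.lie_pos x hx j hj
    have hδ : T.wt x + wordWt T.wt (j :: l : List ι) - T.τ =
        T.wt j + (T.wt x + wordWt T.wt l - T.τ) := by
      rw [← Multiset.cons_coe, wordWt_cons]; abel
    have hcomm : T.e x • word T.e (j :: l) • q =
        T.e j • T.e x • word T.e l • q + ∑ k ∈ a.support, a k • T.e k • word T.e l • q := by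
      have : T.e x * T.e j = T.e j * T.e x + ∑ k ∈ a.support, a k • T.e k := by rw [← ha]; abel
      rw [word_cons, ← mul_smul, ← mul_assoc, this, add_mul, add_smul, mul_assoc, mul_smul,
        mul_smul, Finset.sum_mul, Finset.sum_smul]
      congr 1
      refine Finset.sum_congr rfl fun k _ => ?_
      rw [smul_mul_assoc, smul_assoc, mul_smul]
    have h1 := smul_mem_low hj (ih x hx)
    rw [← hδ] at h1
    have h2 := smul_contraction_sub_mem (Q := Q) harr x j hx l hl hq
    -- The commutator `⁅x, j⁆` contributes `ψ ⁅x, j⁆` if its weight is `τ`. Otherwise the weight of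
    -- the resulting terms is too low, because raising letters of weight less than `τ` have `ψ = 0`.
    have h3 : ∀ k ∈ a.support, T.e k • word T.e l • q -
        (if T.wt x + T.wt j = T.τ then T.ψ k else 0) • word T.e l • q ∈
        wordSpan T.e Q
          (T.IsLow (T.wt x + wordWt T.wt (j :: l : List ι) - T.τ) (l.length + 1)) := by
      intro k hk
      obtain ⟨hk, hwt⟩ := hak k hk
      have hδ' : T.wt x + wordWt T.wt (j :: l : List ι) - T.τ =
          T.wt k + wordWt T.wt l - T.τ := by
        rw [hwt, ← Multiset.cons_coe, wordWt_cons]; abel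
      rw [hδ', ← hwt]
      rcases hk with hk | rfl | hk
      · have h0 := T.wt_nonneg k hk
        rw [if_neg (T.τ_neg.trans_le h0).ne', zero_smul, sub_zero, ← mul_smul, ← word_cons]
        refine word_smul_mem _ ⟨fun i hi => ?_, Or.inl ?_⟩ hq
        · rcases List.mem_cons.mp hi with rfl | hi
          · exact hk
          · exact hl' i hi
        · rw [← Multiset.cons_coe, wordWt_cons]
          exact lt_sub_iff_add_lt.mpr (add_lt_of_neg_right _ T.τ_neg)
      · rw [if_neg T.lt_wt_z.ne', zero_smul, sub_zero]
        obtain ⟨q', hq', h⟩ := z_smul_word hQ l hl' hq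
        rw [h]
        refine word_smul_mem _ ⟨hl', Or.inl ?_⟩ hq'
        rw [lt_sub_iff_add_lt, add_comm]
        exact add_lt_add_left T.lt_wt_z _
      · have h4 : T.contraction arr k l q ∈ wordSpan T.e Q
            (T.IsLow (T.wt k + wordWt T.wt l - T.τ) (l.length + 1)) := by
          refine multiset_sum_mem _ fun v hv => ?_
          obtain ⟨j', hj', rfl⟩ := Multiset.mem_map.mp hv
          rcases eq_or_ne (T.pair k j') 0 with h0 | h0
          · simp [h0]
          have hj'' : j' ∈ T.neg := hl' j' (Multiset.mem_coe.mp hj')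
          refine Submodule.smul_mem _ _ (word_smul_mem _ ⟨fun i hi => ?_, Or.inr ⟨?_, ?_⟩⟩ hq)
          · rw [← Multiset.mem_coe, harr] at hi
            exact hl' i (Multiset.mem_coe.mp (Multiset.mem_of_mem_erase hi))
          · rw [harr, wordWt_erase _ hj', ← wt_add_wt_of_pair_ne_zero hk hj'' h0]; abel
          · rw [← Multiset.coe_card, harr, Multiset.card_erase_of_mem hj']
            have := Multiset.card_pos_iff_exists_mem.mpr ⟨j', hj'⟩
            rw [Multiset.coe_card] at this ⊢
            simp only [Nat.pred_eq_sub_one]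
            omega
        have h5 : T.ψ k • word T.e l • q - (if T.wt k = T.τ then T.ψ k else 0) • word T.e l • q ∈
            wordSpan T.e Q (T.IsLow (T.wt k + wordWt T.wt l - T.τ) (l.length + 1)) := by
          split_ifs with h
          · simp
          · rcases eq_or_ne (T.ψ k) 0 with h0 | h0
            · simp [h0]
            rw [zero_smul, sub_zero]
            refine Submodule.smul_mem _ _ (word_smul_mem _ ⟨hl', Or.inl ?_⟩ hq)
            rw [lt_sub_iff_add_lt, add_comm]
            exact add_lt_add_left (lt_of_le_of_ne (T.le_wt k hk h0) (Ne.symm h)) _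
        have h6 := wordSpan_mono (e := T.e) (Q := Q) (fun _ => IsLow.mono
          (Or.inr ⟨rfl, Nat.le_succ _⟩)) (ih k hk)
        have h7 := Submodule.add_mem _ (Submodule.add_mem _ h6 h4) h5
        convert h7 using 1
        abel
    have h4 : ∑ k ∈ a.support, a k • T.e k • word T.e l • q - T.pair x j • word T.e l • q ∈
        wordSpan T.e Q
          (T.IsLow (T.wt x + wordWt T.wt (j :: l : List ι) - T.τ) (l.length + 1)) := by
      have : T.pair x j • word T.e l • q = ∑ k ∈ a.support,
          a k • (if T.wt x + T.wt j = T.τ then T.ψ k else 0) • word T.e l • q := by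
        rw [hp]
        split_ifs
        · rw [Finset.sum_smul]
          exact Finset.sum_congr rfl fun k _ => mul_smul _ _ _
        · simp
      rw [this, ← Finset.sum_sub_distrib]
      refine Submodule.sum_mem _ fun k hk => ?_
      rw [← smul_sub]
      exact Submodule.smul_mem _ _ (h3 k hk)
    have h5 := Submodule.add_mem _ (Submodule.add_mem _ h1 h2) h4
    rw [List.length_cons]
    convert h5 using 1
    rw [hcomm, word_cons, mul_smul, smul_sub, smul_sub, smul_comm (T.ψ x)]
    abel

end TriangularData

end Leading

/-! ### Uniqueness of expansions -/

section Expansion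

variable {𝕜 U V ι Γ : Type*} [Field 𝕜] [Ring U] [Algebra 𝕜 U] [AddCommGroup V] [Module 𝕜 V]
  [Module U V] [IsScalarTower 𝕜 U V]

/-- The vector `∑ m, word e (arr m) • F m` with coefficients `F`, where `arr` arranges each
multiset of letters into a word. -/
noncomputable def expand (e : ι → U) (arr : Multiset ι → List ι) : (Multiset ι →₀ V) →ₗ[𝕜] V :=
  Finsupp.lsum 𝕜 fun m => Algebra.lsmul 𝕜 𝕜 V (word e (arr m))

theorem expand_apply (e : ι → U) (arr : Multiset ι → List ι) (F : Multiset ι →₀ V) :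
    expand (𝕜 := 𝕜) e arr F = ∑ m ∈ F.support, word e (arr m) • F m := rfl

@[simp] theorem expand_single (e : ι → U) (arr : Multiset ι → List ι) (m : Multiset ι) (v : V) :
    expand (𝕜 := 𝕜) e arr (Finsupp.single m v) = word e (arr m) • v := by
  simp [expand]

/-- The families of coefficients in `Q` supported on the multisets satisfying `P`. -/
def coeffs (Q : Submodule 𝕜 V) (P : Multiset ι → Prop) : Submodule 𝕜 (Multiset ι →₀ V) where
  carrier := {F | ∀ m, F m ∈ Q ∧ (F m ≠ 0 → P m)}
  zero_mem' := by simp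
  add_mem' {F G} hF hG m := by
    refine ⟨Q.add_mem (hF m).1 (hG m).1, fun h => ?_⟩
    by_cases hm : F m = 0
    · exact (hG m).2 fun hm' => h (by simp [hm, hm'])
    · exact (hF m).2 hm
  smul_mem' c F hF m :=
    ⟨Q.smul_mem c (hF m).1, fun h => (hF m).2 fun hm => h (by simp [hm])⟩

theorem single_mem_coeffs {Q : Submodule 𝕜 V} {P : Multiset ι → Prop} {m : Multiset ι} {q : V}
    (hq : q ∈ Q) (hm : q ≠ 0 → P m) : Finsupp.single m q ∈ coeffs Q P := by
  classical
  intro m'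
  rw [Finsupp.single_apply]
  split_ifs with h
  · exact ⟨hq, fun h' => h ▸ hm h'⟩
  · exact ⟨Q.zero_mem, fun h' => absurd rfl h'⟩

theorem coeffs_mono {Q : Submodule 𝕜 V} {P P' : Multiset ι → Prop} (h : ∀ m, P m → P' m) :
    coeffs Q P ≤ coeffs Q P' := fun _ hF m => ⟨(hF m).1, fun hm => h m ((hF m).2 hm)⟩

variable {arr : Multiset ι → List ι} (harr : ∀ m, (arr m : Multiset ι) = m)

include harr in
theorem wordSpan_arranged_le {e : ι → U} {Q : Submodule 𝕜 V} {P : List ι → Prop}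
    {P' : Multiset ι → Prop} (h : ∀ l, P l → P' l) :
    wordSpan e Q (fun l => P l ∧ ∃ m, l = arr m) ≤ (coeffs Q P').map (expand e arr) := by
  refine wordSpan_le ?_
  rintro _ ⟨hl, m, rfl⟩ q hq
  refine ⟨Finsupp.single m q, single_mem_coeffs hq fun _ => ?_, expand_single ..⟩
  simpa only [harr] using h _ hl

include harr in
/-- The span of all words in a closed set of letters is the set of all expansions in arranged
words. -/
theorem wordSpan_le_map_expand [AddCommGroup Γ] {e : ι → U} {N : Set ι} {wt : ι → Γ}
    (hN : LieClosed 𝕜 e N wt) (Q : Submodule 𝕜 V) :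
    wordSpan e Q (fun l => ∀ i ∈ l, i ∈ N) ≤
      (coeffs Q fun m => ∀ i ∈ m, i ∈ N).map (expand e arr) := by
  refine wordSpan_le fun l hl q hq => ?_
  have h := wordSpan_isShort_le_arranged arr harr hN (Q := Q) (wordWt wt l) (l.length + 1)
    (word_smul_mem e ⟨hl, rfl, Nat.lt_succ_self _⟩ hq)
  exact wordSpan_arranged_le harr (fun l hl i hi => hl.1 i hi) h

end Expansion

namespace TriangularData

variable {𝕜 U V ι Γ : Type*} [Field 𝕜] [Ring U] [Algebra 𝕜 U] [AddCommGroup V] [Module 𝕜 V]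
  [Module U V] [IsScalarTower 𝕜 U V] [AddCommGroup Γ] [LinearOrder Γ]
  {T : TriangularData 𝕜 U ι Γ} {Q : Submodule 𝕜 V}
  {arr : Multiset ι → List ι} (harr : ∀ m, (arr m : Multiset ι) = m)

include harr in
theorem low_le_map_expand (δ : Γ) (k : ℕ) :
    wordSpan T.e Q (T.IsLow δ k) ≤ (coeffs Q fun m => (∀ i ∈ m, i ∈ T.neg) ∧
      (wordWt T.wt m < δ ∨ wordWt T.wt m = δ ∧ Multiset.card m + 1 < k)).map
        (expand T.e arr) := by
  refine wordSpan_le fun l hl q hq => ?_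
  have h := wordSpan_isShort_le_arranged arr harr T.closed (Q := Q) (wordWt T.wt l) (l.length + 1)
    (word_smul_mem T.e ⟨hl.1, rfl, Nat.lt_succ_self _⟩ hq)
  refine wordSpan_arranged_le harr (fun l' hl' => ⟨hl'.1, ?_⟩) h
  rw [hl'.2.1]
  have := hl'.2.2
  exact hl.2.imp_right fun h => ⟨h.1, by rw [Multiset.coe_card]; omega⟩

variable [DecidableEq ι]

variable (T) in
/-- The family of coefficients of the contraction by `x`, before any straightening. -/
noncomputable def contractCoeffs (x : ι) (F : Multiset ι →₀ V) : Multiset ι →₀ V :=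
  ∑ m ∈ F.support, (m.map fun j => Finsupp.single (m.erase j) (T.pair x j • F m)).sum

omit [Module U V] [IsScalarTower 𝕜 U V] in
/-- Contraction is the derivation `∑ j, pair x j • ∂ⱼ` of the polynomial with coefficients `F`. -/
theorem contractCoeffs_apply (x : ι) (F : Multiset ι →₀ V) (m₀ : Multiset ι) (s : Finset ι)
    (hs : ∀ j, F (j ::ₘ m₀) ≠ 0 → j ∈ s) :
    T.contractCoeffs x F m₀ =
      ∑ j ∈ s, T.pair x j • ((m₀.count j + 1 : ℕ) : 𝕜) • F (j ::ₘ m₀) := by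
  have h1 : ∀ m ∈ F.support,
      ((m.map fun j => Finsupp.single (m.erase j) (T.pair x j • F m)).sum : Multiset ι →₀ V) m₀ =
      ∑ j ∈ s, if m = j ::ₘ m₀ then
        T.pair x j • ((m₀.count j + 1 : ℕ) : 𝕜) • F (j ::ₘ m₀) else 0 := by
    intro m hm
    have h2 : ((m.map fun j => Finsupp.single (m.erase j) (T.pair x j • F m)).sum :
        Multiset ι →₀ V) m₀ =
        (m.map fun j => if m.erase j = m₀ then T.pair x j • F m else 0).sum := by
      rw [← Finsupp.applyAddHom_apply, map_multiset_sum, Multiset.map_map]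
      simp [Finsupp.single_apply]
    rw [h2, Finset.sum_multiset_map_count]
    have h3 : ∀ j ∈ m.toFinset, (m.count j • if m.erase j = m₀ then T.pair x j • F m else 0) =
        if m = j ::ₘ m₀ then
          T.pair x j • ((m₀.count j + 1 : ℕ) : 𝕜) • F (j ::ₘ m₀) else 0 := by
      intro j hj
      have hj' : j ∈ m := Multiset.mem_toFinset.mp hj
      have hiff : m.erase j = m₀ ↔ m = j ::ₘ m₀ := by
        constructor
        · rintro rfl; exact (Multiset.cons_erase hj').symm
        · rintro rfl; simp
      simp only [hiff]
      split_ifs with h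
      · rw [h, Multiset.count_cons_self, smul_comm, Nat.cast_smul_eq_nsmul]
      · simp
    rw [Finset.sum_congr rfl h3]
    refine Finset.sum_congr_of_eq_on_inter ?_ ?_ fun _ _ _ => rfl
    · intro j hj hjs
      rw [if_neg]
      rintro rfl
      exact hjs (hs j (Finsupp.mem_support_iff.mp hm))
    · intro j hj hjs
      rw [if_neg]
      rintro rfl
      exact hjs (by simp)
  rw [contractCoeffs, Finsupp.finsetSum_apply, Finset.sum_congr rfl h1, Finset.sum_comm]
  refine Finset.sum_congr rfl fun j _ => ?_
  by_cases h : F (j ::ₘ m₀) = 0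
  · simp [h]
  · rw [Finset.sum_eq_single (j ::ₘ m₀)]
    · simp
    · intro m _ hm; rw [if_neg hm]
    · intro h'; exact absurd (Finsupp.notMem_support_iff.mp h') h

theorem expand_contractCoeffs (x : ι) (F : Multiset ι →₀ V) :
    expand (𝕜 := 𝕜) T.e arr (T.contractCoeffs x F) =
      ∑ m ∈ F.support, T.contraction arr x m (F m) := by
  rw [contractCoeffs, map_sum]
  refine Finset.sum_congr rfl fun m _ => ?_
  rw [map_multiset_sum, Multiset.map_map, contraction]
  congr 1
  refine Multiset.map_congr rfl fun j _ => ?_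
  rw [Function.comp_apply, expand_single, smul_comm]

/-- The coefficients of an expansion whose leading terms have weight `δ` and degree `k`. -/
def bounded (T : TriangularData 𝕜 U ι Γ) (Q : Submodule 𝕜 V) (δ : Γ) (k : ℕ) :
    Submodule 𝕜 (Multiset ι →₀ V) :=
  coeffs Q fun m => (∀ i ∈ m, i ∈ T.neg) ∧
    (wordWt T.wt m < δ ∨ wordWt T.wt m = δ ∧ Multiset.card m ≤ k)

/-- The letter `j` is detected if a combination of lowering letters that is annihilated by the
leading pairing with every raising letter does not involve `j`. -/
def Detected (T : TriangularData 𝕜 U ι Γ) (V : Type*) [AddCommGroup V] [Module 𝕜 V] (j : ι) :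
    Prop :=
  ∀ (s : Finset ι) (g : ι → V), (∀ i ∈ s, i ∈ T.neg) →
    (∀ x ∈ T.pos, ∑ i ∈ s, T.pair x i • g i = 0) → j ∈ s → g j = 0

variable [IsOrderedAddMonoid Γ]

include harr in
/-- If an expansion vanishes, then so does its contraction by `x`, up to lower terms. -/
theorem exists_contractCoeffs_add (hQ : T.IsWhittaker Q) {δ : Γ} {k : ℕ} {F : Multiset ι →₀ V}
    (hF : F ∈ T.bounded Q δ (k + 1)) (h0 : expand (𝕜 := 𝕜) T.e arr F = 0) {x : ι}
    (hx : x ∈ T.pos) :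
    ∃ G : Multiset ι →₀ V,
      (∀ m, wordWt T.wt m = T.wt x + δ - T.τ → Multiset.card m = k → G m = 0) ∧
      T.contractCoeffs x F + G ∈ T.bounded Q (T.wt x + δ - T.τ) k ∧
      expand (𝕜 := 𝕜) T.e arr (T.contractCoeffs x F + G) = 0 := by
  have hcoe : ∀ m ∈ F.support, ∀ i ∈ arr m, i ∈ T.neg := fun m hm i hi => by
    rw [← Multiset.mem_coe, harr] at hi
    exact ((hF m).2 (Finsupp.mem_support_iff.mp hm)).1 i hi
  have hlow : ∀ m ∈ F.support, T.e x • word T.e (arr m) • F m - T.ψ x • word T.e (arr m) • F m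
      - T.contraction arr x m (F m) ∈
      wordSpan T.e Q (T.IsLow (T.wt x + δ - T.τ) (k + 1)) := by
    intro m hm
    have h := pos_smul_word harr hQ (arr m) (hcoe m hm) (hF m).1 x hx
    rw [harr, ← Multiset.coe_card, harr] at h
    refine wordSpan_mono (fun _ => IsLow.mono ?_) h
    refine ((hF m).2 (Finsupp.mem_support_iff.mp hm)).2.imp (fun h => by gcongr) fun h => ?_
    exact ⟨by rw [h.1], h.2⟩
  have hsum := Submodule.sum_mem _ hlow
  obtain ⟨G, hG, hG'⟩ := low_le_map_expand harr _ _ hsum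
  have hexp : expand (𝕜 := 𝕜) T.e arr (T.contractCoeffs x F + G) = 0 := by
    rw [map_add, hG', expand_contractCoeffs, Finset.sum_sub_distrib, Finset.sum_sub_distrib,
      ← Finset.smul_sum, ← Finset.smul_sum, ← expand_apply (𝕜 := 𝕜), h0]
    simp
  refine ⟨G, fun m hm hmk => ?_, Submodule.add_mem _ ?_ ?_, hexp⟩
  · by_contra hne
    rcases ((hG m).2 hne).2 with h | h
    · exact h.ne hm
    · have := h.2; omega
  · refine Submodule.sum_mem _ fun m hm => multiset_sum_mem _ fun f hf => ?_
    obtain ⟨j, hj, rfl⟩ := Multiset.mem_map.mp hf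
    have hm' := (hF m).2 (Finsupp.mem_support_iff.mp hm)
    refine single_mem_coeffs (Q.smul_mem _ (hF m).1) fun hne => ⟨fun i hi =>
      hm'.1 i (Multiset.mem_of_mem_erase hi), ?_⟩
    have hp := wt_add_wt_of_pair_ne_zero hx (hm'.1 j hj) (left_ne_zero_of_smul hne)
    have hw : wordWt T.wt (m.erase j) = T.wt x + wordWt T.wt m - T.τ := by
      rw [wordWt_erase _ hj, ← hp]; abel
    rw [hw]
    refine hm'.2.imp (fun h => by gcongr) fun h => ⟨by rw [h.1], ?_⟩
    rw [Multiset.card_erase_of_mem hj, Nat.pred_eq_sub_one]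
    omega
  · refine coeffs_mono (fun m hm => ⟨hm.1, hm.2.imp_right fun h => ⟨h.1, by omega⟩⟩) hG

include harr in
/-- If the leading coefficients of degree `k` of vanishing expansions are zero, then so are those of
degree `k + 1` at the multisets that contain a
detected letter. -/
theorem leading_eq_zero_of_detected [CharZero 𝕜] (hQ : T.IsWhittaker Q) {δ : Γ} {k : ℕ}
    (ih : ∀ δ', ∀ F ∈ T.bounded Q δ' k, expand (𝕜 := 𝕜) T.e arr F = 0 →
      ∀ m, wordWt T.wt m = δ' → Multiset.card m = k → F m = 0)
    {F : Multiset ι →₀ V} (hF : F ∈ T.bounded Q δ (k + 1)) (h0 : expand (𝕜 := 𝕜) T.e arr F = 0)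
    {m : Multiset ι} (hm : wordWt T.wt m = δ) (hmk : Multiset.card m = k + 1) {j : ι} (hj : j ∈ m)
    (hd : T.Detected V j) : F m = 0 := by
  classical
  by_contra hne
  obtain ⟨m₀, rfl⟩ := Multiset.exists_cons_of_mem hj
  rw [wordWt_cons] at hm
  rw [Multiset.card_cons] at hmk
  let s₀ : Finset ι := F.support.biUnion Multiset.toFinset
  have hs₀ : ∀ i, F (i ::ₘ m₀) ≠ 0 → i ∈ s₀ := fun i hi =>
    Finset.mem_biUnion.mpr ⟨i ::ₘ m₀, Finsupp.mem_support_iff.mpr hi, by simp⟩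
  let s : Finset ι := s₀.filter fun i => F (i ::ₘ m₀) ≠ 0 ∧ T.wt i = T.wt j
  have hneg : ∀ i, F (i ::ₘ m₀) ≠ 0 → i ∈ T.neg := fun i hi => ((hF _).2 hi).1 i (by simp)
  have key := hd s (fun i => ((m₀.count i + 1 : ℕ) : 𝕜) • F (i ::ₘ m₀))
    (fun i hi => hneg i (Finset.mem_filter.mp hi).2.1) (fun x hx => ?_)
    (Finset.mem_filter.mpr ⟨hs₀ j hne, hne, rfl⟩)
  · exact hne ((smul_eq_zero.mp key).resolve_left (Nat.cast_ne_zero.mpr (Nat.succ_ne_zero _)))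
  · by_cases hxj : T.wt x + T.wt j = T.τ
    · obtain ⟨G, hG, hFG, h0'⟩ := exists_contractCoeffs_add harr hQ hF h0 hx
      have hδ : wordWt T.wt m₀ = T.wt x + δ - T.τ := by rw [← hm, ← hxj]; abel
      have h1 := ih _ _ hFG h0' m₀ hδ (by omega)
      rw [Finsupp.add_apply, hG m₀ hδ (by omega), add_zero,
        contractCoeffs_apply x F m₀ s₀ hs₀] at h1
      rw [← h1]
      refine Finset.sum_subset (Finset.filter_subset _ _) fun i hi his => ?_
      by_cases hFi : F (i ::ₘ m₀) = 0
      · simp [hFi]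
      have : T.pair x i = 0 := by
        by_contra hp
        refine his (Finset.mem_filter.mpr ⟨hi, hFi, ?_⟩)
        have := wt_add_wt_of_pair_ne_zero hx (hneg i hFi) hp
        exact add_left_cancel (this.trans hxj.symm)
      rw [this, zero_smul]
    · refine Finset.sum_eq_zero fun i hi => ?_
      have hi' := (Finset.mem_filter.mp hi).2
      have : T.pair x i = 0 := by
        by_contra hp
        exact hxj (hi'.2 ▸ wt_add_wt_of_pair_ne_zero hx (hneg i hi'.1) hp)
      rw [this, zero_smul]

include harr in
/-- Expansions in arranged words with coefficients in a space of Whittaker vectors are unique, if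
this is known for those whose leading terms involve no detected letter. -/
theorem eq_zero_of_expand_eq_zero [CharZero 𝕜] (hQ : T.IsWhittaker Q)
    (base : ∀ δ k, ∀ F ∈ T.bounded Q δ k, expand (𝕜 := 𝕜) T.e arr F = 0 →
      (∀ m, F m ≠ 0 → wordWt T.wt m = δ → Multiset.card m = k → ∀ j ∈ m, ¬ T.Detected V j) →
      (∃ m, F m ≠ 0 ∧ wordWt T.wt m = δ ∧ Multiset.card m = k) → F = 0)
    {F : Multiset ι →₀ V} (hF : F ∈ coeffs Q fun m => ∀ i ∈ m, i ∈ T.neg)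
    (h0 : expand (𝕜 := 𝕜) T.e arr F = 0) : F = 0 := by
  have main : ∀ k, ∀ δ, ∀ F ∈ T.bounded Q δ k, expand (𝕜 := 𝕜) T.e arr F = 0 →
      ∀ m, wordWt T.wt m = δ → Multiset.card m = k → F m = 0 := by
    intro k
    induction k with
    | zero =>
      intro δ F hF h0 m hm hmk
      by_contra hne
      refine hne (DFunLike.congr_fun
        (base δ 0 F hF h0 (fun m' _ _ h j hj => ?_) ⟨m, hne, hm, hmk⟩) m)
      rw [Multiset.card_eq_zero.mp h] at hj
      exact absurd hj (Multiset.notMem_zero j)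
    | succ k ih =>
      intro δ F hF h0 m hm hmk
      by_contra hne
      refine hne (DFunLike.congr_fun
        (base δ (k + 1) F hF h0 (fun m' hm' h h' j hj hd => ?_) ⟨m, hne, hm, hmk⟩) m)
      exact hm' (leading_eq_zero_of_detected harr hQ ih hF h0 h h' hj hd)
  by_contra hne
  obtain ⟨m, hm, hmax⟩ := F.support.exists_max_image
    (fun m => toLex (wordWt T.wt m, Multiset.card m)) (Finsupp.support_nonempty_iff.mpr hne)
  refine Finsupp.mem_support_iff.mp hm (main _ _ F (fun m' => ⟨(hF m').1, fun h =>
    ⟨(hF m').2 h, ?_⟩⟩) h0 m rfl rfl)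
  exact Prod.Lex.toLex_le_toLex.mp (hmax m' (Finsupp.mem_support_iff.mpr h))

end TriangularData

/-! ### The derivations of the torus as triangular data -/

/-- The index of a basis vector `d i α` of `ℒ`. -/
abbrev Letter : Type := Fin 2 × Exponent

/-- The generator `d i α` of `U(ℒ)`. -/
noncomputable def gen (k : Letter) : UL := UniversalEnvelopingAlgebra.ι ℂ (d k.1 k.2)

/-- The letter of `z = d₁(0)`. -/
def zLetter : Letter := (0, 0)

/-- The letters of `𝔟⁻` other than `z`. -/
def negLetters : Set Letter := {k | toLex k.2 ≤ 0 ∧ k ≠ zLetter}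

/-- The letters of `ℒ⁺`. -/
def posLetters : Set Letter := {k | 0 < toLex k.2}

theorem gen_comm (i j : Fin 2) (α β : Exponent) :
    gen (i, α) * gen (j, β) - gen (j, β) * gen (i, α) =
      (β i : ℂ) • gen (j, α + β) - (α j : ℂ) • gen (i, α + β) := by
  have h := (UniversalEnvelopingAlgebra.ι ℂ).map_lie (d i α) (d j β)
  rw [LieRing.of_associative_ring_bracket, bracket_d] at h
  simpa [gen] using h.symm

theorem toLex_pos_iff {α : Exponent} : 0 < toLex α ↔ 0 < α 0 ∨ α 0 = 0 ∧ 0 < α 1 := by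
  constructor
  · rintro ⟨i, hi, h⟩
    fin_cases i
    · exact Or.inl h
    · exact Or.inr ⟨(hi 0 (by simp)).symm, h⟩
  · rintro (h | ⟨h, h'⟩)
    · exact ⟨0, fun j hj => absurd hj (by omega), h⟩
    · refine ⟨1, fun j hj => ?_, h'⟩
      have : j = 0 := by omega
      subst this
      exact h.symm

theorem toLex_nonpos_iff {α : Exponent} : toLex α ≤ 0 ↔ α 0 < 0 ∨ α 0 = 0 ∧ α 1 ≤ 0 := by
  refine not_lt.symm.trans ((not_congr toLex_pos_iff).trans ?_)
  omega

theorem exponent_ext {α β : Exponent} (h₀ : α 0 = β 0) (h₁ : α 1 = β 1) : α = β := by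
  funext i
  fin_cases i
  · exact h₀
  · exact h₁

@[simp] theorem kEps_zero_apply (k : ℤ) : kEps k 0 = 0 := rfl

@[simp] theorem kEps_one_apply (k : ℤ) : kEps k 1 = k := rfl

variable (ψ : LPlus →ₗ⁅ℂ⁆ ℂ)

open Classical in
/-- The character `ψ` on the letters of `ℒ⁺`, extended by zero. -/
noncomputable def psiLetter (k : Letter) : ℂ :=
  if h : 0 < toLex k.2 then ψ (dPlus k.1 k.2 h) else 0

theorem psiLetter_of_pos (i : Fin 2) {α : Exponent} (h : 0 < toLex α) :
    psiLetter ψ (i, α) = ψ (dPlus i α h) := dif_pos h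

/-- A character of a Lie algebra vanishes on commutators. -/
theorem psiLetter_bracket (i j : Fin 2) {α β : Exponent} (hα : 0 < toLex α) (hβ : 0 < toLex β) :
    (β i : ℂ) * psiLetter ψ (j, α + β) = α j * psiLetter ψ (i, α + β) := by
  have hαβ : 0 < toLex (α + β) := add_pos (α := Lex Exponent) hα hβ
  have h : ⁅dPlus i α hα, dPlus j β hβ⁆ =
      (β i : ℂ) • dPlus j (α + β) hαβ - (α j : ℂ) • dPlus i (α + β) hαβ :=
    Subtype.ext (bracket_d i j α β)
  have h' := ψ.map_lie (dPlus i α hα) (dPlus j β hβ)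
  rw [h, LieRing.of_associative_ring_bracket, mul_comm, sub_self, map_sub, map_smul, map_smul,
    sub_eq_zero] at h'
  rw [psiLetter_of_pos ψ _ hαβ, psiLetter_of_pos ψ _ hαβ]
  exact h'

/-- A character of `ℒ⁺` vanishes outside `d₁(ε₂)`, `d₂(ε₂)` and `d₂(2ε₂)`. -/
theorem eq_of_psiLetter_ne_zero {i : Fin 2} {α : Exponent} (h : psiLetter ψ (i, α) ≠ 0) :
    α 0 = 0 ∧ (α 1 = 1 ∨ α 1 = 2 ∧ i = 1) := by
  have hα : 0 < toLex α := by
    by_contra h'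
    exact h (dif_neg h')
  have key : ∀ i j : Fin 2, 0 < toLex (α - kEps 1) →
      ((α i : ℂ) - kEps 1 i) * psiLetter ψ (j, α) = kEps 1 j * psiLetter ψ (i, α) := by
    intro i j hβ
    have := psiLetter_bracket ψ i j (kEps_pos one_pos) hβ
    rw [add_sub_cancel] at this
    simpa using this
  rcases toLex_pos_iff.mp hα with h0 | ⟨h0, h1⟩
  · exfalso
    have hβ : 0 < toLex (α - kEps 1) := toLex_pos_iff.mpr (Or.inl (by simpa using h0))
    have hne : (α 0 : ℂ) ≠ 0 := by exact_mod_cast h0.ne'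
    have h00 := key 0 0 hβ
    have h01 := key 0 1 hβ
    simp only [kEps_zero_apply, Int.cast_zero, sub_zero, zero_mul, mul_eq_zero, hne,
      false_or] at h00
    simp only [kEps_zero_apply, kEps_one_apply, Int.cast_zero, sub_zero, h00, mul_zero, mul_eq_zero,
      hne, false_or] at h01
    fin_cases i
    · exact h h00
    · exact h h01
  · refine ⟨h0, ?_⟩
    by_contra! h'
    have h2 : 2 ≤ α 1 := by omega
    have hβ : 0 < toLex (α - kEps 1) :=
      toLex_pos_iff.mpr (Or.inr ⟨by simpa using h0, by simp; omega⟩)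
    fin_cases i
    · have h10 := key 1 0 hβ
      have hne : (α 1 : ℂ) - 1 ≠ 0 := by
        rw [sub_ne_zero]; exact_mod_cast h'.1
      simp only [kEps_zero_apply, kEps_one_apply, Int.cast_zero, Int.cast_one, zero_mul,
        mul_eq_zero, hne, false_or] at h10
      exact h h10
    · have h11 := key 1 1 hβ
      have hne : (α 1 : ℂ) - 2 ≠ 0 := by
        rw [sub_ne_zero]
        intro h2
        exact h'.2 (by exact_mod_cast h2) rfl
      simp only [kEps_one_apply, Int.cast_one, one_mul] at h11
      have : ((α 1 : ℂ) - 2) * psiLetter ψ (1, α) = 0 := by linear_combination h11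
      exact h ((mul_eq_zero.mp this).resolve_left hne)

section Data

variable {Γ : Type*} [AddCommGroup Γ] [LinearOrder Γ]

open Classical in
/-- The triangular data of the subalgebra of `ℒ` spanned by the `d i α` with `α ∈ A`, for a
grading `wt` of this subalgebra. -/
noncomputable def torusData (A : AddSubmonoid Exponent) (wt : Letter → Γ) (τ : Γ) (τ_neg : τ < 0)
    (wt_add : ∀ i j, ∀ α ∈ A, ∀ β ∈ A, β i ≠ 0 → wt (j, α + β) = wt (i, α) + wt (j, β))
    (wt_nonneg : ∀ k ∈ negLetters, k.2 ∈ A → 0 ≤ wt k) (lt_wt_z : τ < wt zLetter)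
    (le_wt : ∀ k, psiLetter ψ k ≠ 0 → τ ≤ wt k) : TriangularData ℂ UL Letter Γ where
  e := gen
  neg := {k | k ∈ negLetters ∧ k.2 ∈ A}
  pos := {k | k ∈ posLetters ∧ k.2 ∈ A}
  z := zLetter
  wt := wt
  ψ := psiLetter ψ
  τ := τ
  pair x j := if wt x + wt j = τ then (j.2 x.1 : ℂ) * psiLetter ψ (j.1, x.2 + j.2) -
    (x.2 j.1 : ℂ) * psiLetter ψ (x.1, x.2 + j.2) else 0
  τ_neg := τ_neg
  wt_nonneg := fun k hk => wt_nonneg k hk.1 hk.2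
  lt_wt_z := lt_wt_z
  le_wt := fun k _ => le_wt k
  closed := by
    rintro ⟨i, α⟩ ⟨⟨hα, hi⟩, hαA⟩ ⟨j, β⟩ ⟨⟨hβ, hj⟩, hβA⟩
    simp only at hα hαA hβ hβA
    rw [gen_comm]
    by_cases h0 : α + β = 0
    · have hα0 : α = 0 := by
        have h₁ := toLex_nonpos_iff.mp hα
        have h₂ := toLex_nonpos_iff.mp hβ
        have h₃ := congrFun h0 0
        have h₄ := congrFun h0 1
        simp only [Pi.add_apply, Pi.zero_apply] at h₃ h₄
        exact exponent_ext (by simp; omega) (by simp; omega)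
      have hβ0 : β = 0 := by simpa [hα0] using h0
      simp [hα0, hβ0]
    · have hneg : ∀ i : Fin 2, (i, α + β) ∈ negLetters := fun i =>
        ⟨add_nonpos (α := Lex Exponent) hα hβ, fun h => h0 (Prod.ext_iff.mp h).2⟩
      refine Submodule.sub_mem _ ?_ ?_
      · rcases eq_or_ne (β i) 0 with h | h
        · simp [h]
        · exact Submodule.smul_mem _ _ (Submodule.subset_span
            ⟨_, ⟨⟨hneg j, A.add_mem hαA hβA⟩, wt_add i j α hαA β hβA h⟩, rfl⟩)
      · rcases eq_or_ne (α j) 0 with h | h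
        · simp [h]
        · refine Submodule.smul_mem _ _ (Submodule.subset_span
            ⟨_, ⟨⟨hneg i, A.add_mem hαA hβA⟩, ?_⟩, rfl⟩)
          rw [add_comm α β, wt_add j i β hβA α hαA h, add_comm]
  lie_z := by
    rintro ⟨j, β⟩ -
    refine ⟨β 0, ?_⟩
    rw [zLetter, gen_comm]
    simp
  lie_pos := by
    rintro ⟨i, α⟩ ⟨hα, hαA⟩ ⟨j, β⟩ ⟨-, hβA⟩
    simp only at hα hαA hβA
    refine ⟨Finsupp.single (j, α + β) (β i : ℂ) - Finsupp.single (i, α + β) (α j : ℂ), ?_, ?_, ?_⟩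
    · change _ = Finsupp.linearCombination ℂ gen _
      rw [gen_comm]
      simp
    · intro k hk
      have hk' : (k = (j, α + β) ∧ β i ≠ 0) ∨ (k = (i, α + β) ∧ α j ≠ 0) := by
        by_contra! h
        refine Finsupp.mem_support_iff.mp hk ?_
        rw [Finsupp.sub_apply, Finsupp.single_apply, Finsupp.single_apply]
        have h₁ := h.1
        have h₂ := h.2
        split_ifs with h₃ h₄ h₄
        · simp [h₁ h₃.symm, h₂ h₄.symm]
        · simp [h₁ h₃.symm]
        · simp [h₂ h₄.symm]
        · simp
      have hwt : wt k = wt (i, α) + wt (j, β) ∧ k.2 = α + β := by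
        rcases hk' with ⟨rfl, h⟩ | ⟨rfl, h⟩
        · exact ⟨wt_add i j α hαA β hβA h, rfl⟩
        · refine ⟨?_, rfl⟩
          rw [add_comm α β, wt_add j i β hβA α hαA h, add_comm]
      refine ⟨?_, hwt.1⟩
      have hA : k.2 ∈ A := hwt.2 ▸ A.add_mem hαA hβA
      by_cases hz : k = zLetter
      · exact Or.inr (Or.inl hz)
      · rcases le_or_gt (toLex k.2) 0 with h | h
        · exact Or.inl ⟨⟨h, hz⟩, hA⟩
        · exact Or.inr (Or.inr ⟨h, hA⟩)
    · congr 1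
      change _ = Finsupp.linearCombination ℂ (psiLetter ψ) _
      simp

end Data

/-- The exponents `(0, k)`. -/
def axis : AddSubmonoid Exponent where
  carrier := {α | α 0 = 0}
  zero_mem' := rfl
  add_mem' {α β} hα hβ := by
    change α 0 + β 0 = 0
    rw [hα, hβ, add_zero]

/-- The triangular data of `ℒ`, graded by the exponents. -/
noncomputable def fullData : TriangularData ℂ UL Letter (Lex Exponent) :=
  torusData ψ ⊤ (fun k => -toLex k.2) (-toLex (kEps 2)) (neg_neg_of_pos (kEps_pos two_pos))
    (fun i j α _ β _ _ => by rw [toLex_add, neg_add])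
    (fun k hk _ => neg_nonneg.mpr hk.1)
    (by
      change -toLex (kEps 2) < -toLex 0
      rw [toLex_zero, neg_zero]
      exact neg_neg_of_pos (kEps_pos two_pos))
    (by
      rintro ⟨i, α⟩ h
      have h' := eq_of_psiLetter_ne_zero ψ h
      rw [neg_le_neg_iff, ← sub_nonpos, ← toLex_sub, toLex_nonpos_iff]
      refine Or.inr ⟨by simp [h'.1], ?_⟩
      simp only [Pi.sub_apply, kEps_one_apply]
      omega)

/-- The triangular data of the subalgebra spanned by the `d i (0, k)`, with a grading in which
`d₁(k ε₂)` has the same weight as `d₂((k + 1) ε₂)`. For this grading, the terms of lowest weight in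
`ψ` are those at `d₁(ε₂)` and `d₂(2ε₂)`. -/
noncomputable def axisData : TriangularData ℂ UL Letter ℤ :=
  torusData ψ axis (fun k => -k.2 1 - if k.1 = 0 then 1 else 0) (-2) (by norm_num)
    (fun i j α hα β hβ h => by
      have hi : i = 1 := by
        by_contra hi
        have : i = 0 := by omega
        exact h (this ▸ hβ)
      subst hi
      simp only [Pi.add_apply, one_ne_zero, if_false]
      ring)
    (by
      rintro ⟨i, α⟩ ⟨hα, hz⟩ (hA : α 0 = 0)
      have h := toLex_nonpos_iff.mp hα
      simp only at h ⊢
      split_ifs with hi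
      · have : α 1 ≠ 0 := fun h1 => hz (by rw [hi, zLetter, exponent_ext (β := 0) hA h1])
        omega
      · omega)
    (by simp [zLetter])
    (by
      rintro ⟨i, α⟩ h
      have h' := (eq_of_psiLetter_ne_zero ψ h).2
      simp only
      split_ifs with hi
      · subst hi
        have : α 1 = 1 := by simpa using h'
        omega
      · omega)

variable {V : Type*} [AddCommGroup V] [Module ℂ V]

theorem pair_eq_fullData (i j : Fin 2) (α β : Exponent) (h : α + β = kEps 2) :
    (fullData ψ).pair (i, α) (j, β) = (β i : ℂ) * psiLetter ψ (j, kEps 2) -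
      (α j : ℂ) * psiLetter ψ (i, kEps 2) := by
  refine (if_pos ?_).trans (by simp only [h])
  change -toLex α + -toLex β = -toLex (kEps 2)
  rw [← neg_add, ← toLex_add, h]

variable {ψ}

theorem Nonsingular.one_two (hψ : Nonsingular ψ) : psiLetter ψ (1, kEps 2) ≠ 0 := by
  rw [psiLetter_of_pos ψ _ (kEps_pos two_pos)]
  exact hψ.2.2

theorem Nonsingular.zero_one (hψ : Nonsingular ψ) : psiLetter ψ (0, kEps 1) ≠ 0 := by
  rw [psiLetter_of_pos ψ _ (kEps_pos one_pos)]
  exact hψ.1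

theorem psiLetter_zero_two : psiLetter ψ (0, kEps 2) = 0 := by
  by_contra h
  simpa using (eq_of_psiLetter_ne_zero ψ h).2

/-- For the grading by exponents, the letters `d j β` with `β 0 ≠ 0` are detected: the leading
pairing of the `d i (2ε₂ - β)` with the `d j β` has the matrix `ψ(d₂(2ε₂)) * !![0, β 0; β 0, *]`. -/
theorem detected_fullData (hψ : Nonsingular ψ) {j : Fin 2} {β : Exponent} (hβ : β 0 ≠ 0) :
    (fullData ψ).Detected V (j, β) := by
  intro s g hs hx hj
  have hβ' : (β 0 : ℂ) ≠ 0 := by exact_mod_cast hβ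
  have hψ2 := hψ.one_two
  have hneg : β 0 < 0 := by
    have := toLex_nonpos_iff.mp (hs _ hj).1.1
    simp only at this
    omega
  have hα : ∀ i, (i, kEps 2 - β) ∈ (fullData ψ).pos := fun i =>
    ⟨toLex_pos_iff.mpr (Or.inl (by simpa using hneg)), trivial⟩
  have hexp : kEps 2 - β + β = kEps 2 := sub_add_cancel _ _
  have hother : ∀ i, ∀ k ∈ s, k.2 ≠ β → (fullData ψ).pair (i, kEps 2 - β) k = 0 := by
    intro i k hk hkβ
    by_contra h
    have h' := TriangularData.wt_add_wt_of_pair_ne_zero (hα i) (hs k hk) h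
    change -toLex (kEps 2 - β) + -toLex k.2 = -toLex (kEps 2) at h'
    rw [← neg_add, neg_inj, ← toLex_add, toLex_inj] at h'
    exact hkβ (by rw [← add_right_inj, h', hexp])
  have h1 : (1, β) ∈ s → g (1, β) = 0 := by
    intro h1
    have h := hx _ (hα 0)
    rw [Finset.sum_eq_single (1, β)] at h
    · rw [pair_eq_fullData _ _ _ _ _ hexp, psiLetter_zero_two, mul_zero, sub_zero] at h
      exact (smul_eq_zero.mp h).resolve_left (mul_ne_zero hβ' hψ2)
    · rintro ⟨i, γ⟩ hi hne
      by_cases hγ : γ = β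
      · subst hγ
        have hi0 : i = 0 := by
          by_contra h0
          exact hne (by rw [show i = 1 by omega])
        subst hi0
        rw [pair_eq_fullData _ _ _ _ _ hexp, psiLetter_zero_two]
        simp
      · rw [hother _ _ hi hγ, zero_smul]
    · exact fun h => absurd h1 h
  have h0 : (0, β) ∈ s → g (0, β) = 0 := by
    intro h0
    have h := hx _ (hα 1)
    rw [Finset.sum_eq_single (0, β)] at h
    · rw [pair_eq_fullData _ _ _ _ _ hexp, psiLetter_zero_two] at h
      refine (smul_eq_zero.mp h).resolve_left ?_
      simpa using ⟨hβ, hψ2⟩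
    · rintro ⟨i, γ⟩ hi hne
      by_cases hγ : γ = β
      · subst hγ
        have hi1 : i = 1 := by
          by_contra h1
          exact hne (by rw [show i = 0 by omega])
        subst hi1
        rw [h1 hi, smul_zero]
      · rw [hother _ _ hi hγ, zero_smul]
    · exact fun h => absurd h0 h
  fin_cases j
  · exact h0 hj
  · exact h1 hj

theorem kEps_add (k l : ℤ) : kEps k + kEps l = kEps (k + l) := exponent_ext rfl rfl

theorem pair_eq_axisData (i j : Fin 2) (k l : ℤ)
    (h : -k - (if i = 0 then 1 else 0) + (-l - if j = 0 then 1 else 0) = -2) :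
    (axisData ψ).pair (i, kEps k) (j, kEps l) = (kEps l i : ℂ) * psiLetter ψ (j, kEps (k + l)) -
      (kEps k j : ℂ) * psiLetter ψ (i, kEps (k + l)) := by
  refine (if_pos h).trans ?_
  simp only [kEps_add]

/-- For the shifted grading, all letters of the axis are detected through `ψ(d₁(ε₂))`. -/
theorem detected_axisData (hψ : Nonsingular ψ) (j : Letter) : (axisData ψ).Detected V j := by
  intro s g hs hx hj
  have hψ1 := hψ.zero_one
  have haxis : ∀ k ∈ s, ∃ i l, k = (i, kEps l) := fun k hk =>
    ⟨k.1, k.2 1, Prod.ext rfl (exponent_ext (hs k hk).2 rfl)⟩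
  have hle : ∀ i k, (i, kEps k) ∈ s → k ≤ 0 := fun i k hk => by
    have := toLex_nonpos_iff.mp (hs _ hk).1.1
    simpa using this
  have hpos : ∀ i, ∀ k : ℤ, 0 < k → (i, kEps k) ∈ (axisData ψ).pos := fun i k hk =>
    ⟨kEps_pos hk, rfl⟩
  have hwt : ∀ i k, 0 < k → ∀ j l, (j, kEps l) ∈ s →
      (axisData ψ).pair (i, kEps k) (j, kEps l) ≠ 0 →
      -k - (if i = 0 then 1 else 0) + (-l - if j = 0 then 1 else 0) = -2 := fun i k hk j l hj h =>
    TriangularData.wt_add_wt_of_pair_ne_zero (hpos i k hk) (hs _ hj) h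
  -- The letter `d₂(k ε₂)` is detected by `d₁((1 - k) ε₂)`
  have h1 : ∀ k : ℤ, (1, kEps k) ∈ s → g (1, kEps k) = 0 := by
    intro k hk
    have hk0 := hle _ _ hk
    have h := hx _ (hpos 0 (1 - k) (by omega))
    rw [Finset.sum_eq_single (1, kEps k)] at h
    · refine (smul_eq_zero.mp h).resolve_left ?_
      rw [pair_eq_axisData _ _ _ _ (by simp; ring), sub_add_cancel]
      refine fun h0 => mul_ne_zero ?_ hψ1 (by simpa using h0)
      rw [sub_ne_zero]
      exact_mod_cast (by omega : 1 ≠ k)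
    · intro m hm hne
      obtain ⟨i, l, rfl⟩ := haxis m hm
      by_contra h0
      have hw := hwt _ _ (by omega) _ _ hm (left_ne_zero_of_smul h0)
      by_cases hi : i = 0
      · subst hi
        rw [pair_eq_axisData _ _ _ _ hw] at h0
        simp at h0
      · obtain rfl : i = 1 := by omega
        simp only [if_true, one_ne_zero, if_false] at hw
        exact hne (by rw [show l = k by omega])
    · exact fun h => absurd hk h
  -- The letter `d₁(k ε₂)` is then detected by `d₂((1 - k) ε₂)`
  have h0 : ∀ k : ℤ, (0, kEps k) ∈ s → g (0, kEps k) = 0 := by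
    intro k hk
    have hk0 : k < 0 := by
      refine lt_of_le_of_ne (hle _ _ hk) ?_
      rintro rfl
      exact (hs _ hk).1.2 (by rw [zLetter]; exact Prod.ext rfl (exponent_ext rfl rfl))
    have h := hx _ (hpos 1 (1 - k) (by omega))
    rw [Finset.sum_eq_single (0, kEps k)] at h
    · refine (smul_eq_zero.mp h).resolve_left ?_
      rw [pair_eq_axisData _ _ _ _ (by simp; ring), sub_add_cancel]
      simpa using ⟨hk0.ne, hψ1⟩
    · intro m hm hne
      obtain ⟨i, l, rfl⟩ := haxis m hm
      by_contra h0
      have hw := hwt _ _ (by omega) _ _ hm (left_ne_zero_of_smul h0)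
      by_cases hi : i = 0
      · subst hi
        simp only [if_true, one_ne_zero, if_false] at hw
        exact hne (by rw [show l = k by omega])
      · obtain rfl : i = 1 := by omega
        exact h0 (by rw [h1 l hm, smul_zero])
    · exact fun h => absurd hk h
  obtain ⟨i, l, rfl⟩ := haxis j hj
  fin_cases i
  · exact h0 l hj
  · exact h1 l hj

section Unique

variable [Module UL V] {Q : Submodule ℂ V}
  {arr : Multiset Letter → List Letter} (harr : ∀ m, (arr m : Multiset Letter) = m)

variable (ψ) in
/-- A `z`-stable space of Whittaker vectors of type `ψ`. -/
structure IsWhittakerSpace (Q : Submodule ℂ V) : Prop where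
  z_mem : ∀ q ∈ Q, gen zLetter • q ∈ Q
  pos_smul : ∀ k ∈ posLetters, ∀ q ∈ Q, gen k • q = psiLetter ψ k • q

theorem IsWhittakerSpace.full (hQ : IsWhittakerSpace ψ Q) : (fullData ψ).IsWhittaker Q :=
  ⟨hQ.z_mem, fun k hk => hQ.pos_smul k hk.1⟩

theorem IsWhittakerSpace.axis (hQ : IsWhittakerSpace ψ Q) : (axisData ψ).IsWhittaker Q :=
  ⟨hQ.z_mem, fun k hk => hQ.pos_smul k hk.1⟩

variable [IsScalarTower ℂ UL V]

include harr in
/-- Uniqueness of expansions in the letters `d i (0, k)`. -/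
theorem eq_zero_of_expand_axis (hψ : Nonsingular ψ) (hQ : IsWhittakerSpace ψ Q)
    {F : Multiset Letter →₀ V}
    (hF : F ∈ coeffs Q fun m => ∀ i ∈ m, i ∈ negLetters ∧ i.2 ∈ TorusWhittaker.axis)
    (h0 : expand (𝕜 := ℂ) gen arr F = 0) : F = 0 := by
  refine TriangularData.eq_zero_of_expand_eq_zero (T := axisData ψ) harr hQ.axis ?_ hF h0
  rintro δ k F hF h0 hd ⟨m, hm, hδ, hk⟩
  have hm0 : m = 0 := Multiset.eq_zero_of_forall_notMem fun j hj =>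
    hd m hm hδ hk j hj (detected_axisData hψ j)
  subst hm0
  have hsupp : ∀ m, F m ≠ 0 → m = 0 := by
    intro m hm
    have h := (hF m).2 hm
    have hwt : 0 ≤ wordWt (axisData ψ).wt m := Multiset.sum_nonneg fun x hx => by
      obtain ⟨i, hi, rfl⟩ := Multiset.mem_map.mp hx
      exact (axisData ψ).wt_nonneg i (h.1 i hi)
    rw [← hδ, ← hk] at h
    rcases h.2 with h | h
    · exact absurd h hwt.not_gt
    · exact Multiset.card_eq_zero.mp (Nat.le_zero.mp h.2)
  have hF0 : F = Finsupp.single 0 (F 0) := by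
    ext m
    rw [Finsupp.single_apply]
    split_ifs with h
    · rw [h]
    · by_contra h'
      exact h (hsupp m h').symm
  have harr0 : arr 0 = [] := by rw [← Multiset.coe_eq_zero, harr]
  change expand (𝕜 := ℂ) gen arr F = 0 at h0
  rw [hF0, expand_single, harr0, word_nil, one_smul] at h0
  rw [hF0, h0, Finsupp.single_zero]

include harr in
/-- A `z`-stable space `Q` of Whittaker vectors generates freely: the expansions in arranged words
in the letters of `𝔟⁻` other than `z`, with coefficients in `Q`, are unique. -/
theorem eq_zero_of_expand_eq_zero (hψ : Nonsingular ψ) (hQ : IsWhittakerSpace ψ Q)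
    {F : Multiset Letter →₀ V} (hF : F ∈ coeffs Q fun m => ∀ i ∈ m, i ∈ negLetters)
    (h0 : expand (𝕜 := ℂ) gen arr F = 0) : F = 0 := by
  refine TriangularData.eq_zero_of_expand_eq_zero (T := fullData ψ) harr hQ.full ?_
    (coeffs_mono (fun m hm i hi => ⟨hm i hi, trivial⟩) hF) h0
  rintro δ k F hF h0 hd ⟨m, hm, hδ, hk⟩
  have hneg : ∀ m, F m ≠ 0 → ∀ i ∈ m, i ∈ negLetters := fun m hm i hi => (((hF m).2 hm).1 i hi).1
  have hm0 : ∀ j ∈ m, j.2 0 = 0 := fun j hj => by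
    by_contra h
    exact hd m hm hδ hk j hj (detected_fullData hψ h)
  -- The first coordinate of the weight of a word is a sum of nonnegative integers. It vanishes at
  -- the leading terms, hence at all terms, so only the letters `d i (0, k)` occur.
  have hwt : ∀ m : Multiset Letter,
      ofLex (wordWt (fullData ψ).wt m) 0 = (m.map fun k => -k.2 0).sum := by
    intro m
    induction m using Multiset.induction with
    | empty => rfl
    | cons i m ih =>
      rw [wordWt_cons, ofLex_add, Pi.add_apply, ih, Multiset.map_cons, Multiset.sum_cons]
      rfl
  have hfirst : ∀ α : Exponent, toLex α ≤ 0 → α 0 ≤ 0 := fun α h => by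
    have := toLex_nonpos_iff.mp h
    omega
  have hδ0 : ofLex δ 0 = 0 := by
    rw [← hδ, hwt]
    refine Multiset.sum_eq_zero fun x hx => ?_
    obtain ⟨i, hi, rfl⟩ := Multiset.mem_map.mp hx
    rw [hm0 i hi, neg_zero]
  refine eq_zero_of_expand_axis harr hψ hQ (fun m' => ⟨(hF m').1, fun h i hi =>
    ⟨hneg m' h i hi, ?_⟩⟩) h0
  have hle : wordWt (fullData ψ).wt m' ≤ δ := ((hF m').2 h).2.elim le_of_lt fun h => h.1.le
  have h1 : (m'.map fun k => -k.2 0).sum ≤ 0 := by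
    have := hfirst (ofLex (wordWt (fullData ψ).wt m' - δ)) (sub_nonpos.mpr hle)
    rw [ofLex_sub, Pi.sub_apply, hwt, hδ0, sub_zero] at this
    exact this
  have h2 : ∀ x ∈ m'.map fun k => -k.2 0, (0 : ℤ) ≤ x := by
    intro x hx
    obtain ⟨i, hi, rfl⟩ := Multiset.mem_map.mp hx
    exact neg_nonneg.mpr (hfirst _ (hneg m' h i hi).1)
  have h3 := Multiset.single_le_sum h2 _ (Multiset.mem_map_of_mem _ hi)
  have h4 := hfirst _ (hneg m' h i hi).1
  change i.2 0 = 0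
  omega

end Unique

/-! ### Generation by Whittaker vectors -/

section Enveloping

variable {R L : Type*} [CommRing R] [LieRing L] [LieAlgebra R L]

/-- The enveloping algebra `U(L)` is generated by `L`. -/
theorem envelopingAlgebra_subalgebra_eq_top
    (S : Subalgebra R (UniversalEnvelopingAlgebra R L))
    (h : ∀ x, UniversalEnvelopingAlgebra.ι R x ∈ S) : S = ⊤ := by
  let f : L →ₗ⁅R⁆ S :=
    { toFun := fun x => ⟨UniversalEnvelopingAlgebra.ι R x, h x⟩
      map_add' := fun x y => Subtype.ext (map_add _ x y)
      map_smul' := fun c x => Subtype.ext (map_smul _ c x)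
      map_lie' := fun {x y} => Subtype.ext ((UniversalEnvelopingAlgebra.ι R).map_lie x y) }
  have hf : S.val.comp (UniversalEnvelopingAlgebra.lift R f) = AlgHom.id R _ := by
    ext x
    change ((UniversalEnvelopingAlgebra.lift R f (UniversalEnvelopingAlgebra.ι R x) : S) :
      UniversalEnvelopingAlgebra R L) = UniversalEnvelopingAlgebra.ι R x
    rw [UniversalEnvelopingAlgebra.lift_ι_apply]
    rfl
  refine eq_top_iff.mpr fun u _ => ?_
  have := DFunLike.congr_fun hf u
  rw [AlgHom.id_apply] at this
  rw [← this]
  exact (UniversalEnvelopingAlgebra.lift R f u).2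

/-- A subspace of a `U(L)`-module that is stable under a spanning set of `L` is a submodule. -/
theorem smul_mem_of_span_eq_top {V : Type*} [AddCommGroup V] [Module R V]
    [Module (UniversalEnvelopingAlgebra R L) V]
    [IsScalarTower R (UniversalEnvelopingAlgebra R L) V] {B : Set L}
    (hB : Submodule.span R B = ⊤) (S : Submodule R V)
    (h : ∀ x ∈ B, ∀ v ∈ S, UniversalEnvelopingAlgebra.ι R x • v ∈ S)
    (u : UniversalEnvelopingAlgebra R L) {v : V} (hv : v ∈ S) : u • v ∈ S := by
  let A : Subalgebra R (UniversalEnvelopingAlgebra R L) :=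
    { carrier := {u | ∀ v ∈ S, u • v ∈ S}
      mul_mem' := fun {a b} ha hb v hv => by rw [mul_smul]; exact ha _ (hb v hv)
      add_mem' := fun {a b} ha hb v hv => by rw [add_smul]; exact S.add_mem (ha v hv) (hb v hv)
      algebraMap_mem' := fun c v hv => by rw [algebraMap_smul]; exact S.smul_mem c hv }
  have hA : A = ⊤ := envelopingAlgebra_subalgebra_eq_top A fun x => by
    have hx : x ∈ Submodule.span R B := hB ▸ Submodule.mem_top
    induction hx using Submodule.span_induction with
    | mem x hx => exact fun v hv => h x hx v hv
    | zero => rw [map_zero]; exact A.zero_mem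
    | add x y _ _ hx hy => rw [map_add]; exact A.add_mem hx hy
    | smul c x _ hx => rw [map_smul]; exact A.smul_mem hx c
  have hu : u ∈ A := hA ▸ Algebra.mem_top
  exact hu v hv

end Enveloping

section Derivations

theorem smul_euler_mem_span (i : Fin 2) (f : Laurent) :
    f • euler i ∈ Submodule.span ℂ (Set.range fun k : Letter => d k.1 k.2) := by
  induction f using AddMonoidAlgebra.induction_linear with
  | zero => rw [zero_smul]; exact Submodule.zero_mem _
  | add f g hf hg => rw [add_smul]; exact Submodule.add_mem _ hf hg
  | single α c =>
    have : (AddMonoidAlgebra.single α c : Laurent) • euler i = c • d i α := by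
      rw [d, ← smul_assoc, AddMonoidAlgebra.smul_single, smul_eq_mul, mul_one]
    rw [this]
    exact Submodule.smul_mem _ _ (Submodule.subset_span ⟨(i, α), rfl⟩)

theorem euler_single (i : Fin 2) (β : Exponent) :
    euler i (AddMonoidAlgebra.single β 1) = AddMonoidAlgebra.single β (β i : ℂ) :=
  (eulerLinear_single i β 1).trans (by rw [mul_one])

/-- The derivations `d i α` span `ℒ`: a derivation `x` is determined by its logarithmic derivatives
`t^{-β} x(t^β)`, which are additive in `β`. -/
theorem span_range_d : Submodule.span ℂ (Set.range fun k : Letter => d k.1 k.2) = ⊤ := by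
  refine eq_top_iff.mpr fun x _ => ?_
  let m : Exponent → Laurent := fun β => AddMonoidAlgebra.single β 1
  have hm : ∀ α β, m (α + β) = m α * m β := fun α β => by
    simp [m, AddMonoidAlgebra.single_mul_single]
  have hm0 : m 0 = 1 := rfl
  have hmn : ∀ β, m (-β) * m β = 1 := fun β => by rw [← hm, neg_add_cancel, hm0]
  let φ : Exponent →+ Laurent :=
    { toFun := fun β => m (-β) * x (m β)
      map_zero' := by rw [hm0, x.map_one_eq_zero, mul_zero]
      map_add' := fun α β => by
        rw [hm, x.leibniz, neg_add, hm, smul_eq_mul, smul_eq_mul]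
        linear_combination (m (-β) * x (m β)) * hmn α + (m (-α) * x (m α)) * hmn β }
  have hφ : ∀ β, φ β = ∑ i, (β i : ℂ) • φ (Pi.single i 1) := by
    intro β
    have h := congrArg φ.toIntLinearMap (pi_eq_sum_univ' β)
    rw [map_sum] at h
    refine h.trans (Finset.sum_congr rfl fun i _ => ?_)
    rw [map_smul, Int.cast_smul_eq_zsmul]
    rfl
  have hx : x = ∑ i, φ (Pi.single i 1) • euler i := by
    refine Derivation.ext fun f => ?_
    induction f using AddMonoidAlgebra.induction_linear with
    | zero => simp only [map_zero]
    | add f g hf hg => rw [map_add, map_add, hf, hg]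
    | single β c =>
      have hc : (AddMonoidAlgebra.single β c : Laurent) = c • m β := by
        simp [m, AddMonoidAlgebra.smul_single]
      rw [hc, Derivation.map_smul, Derivation.map_smul]
      congr 1
      have h1 : x (m β) = m β * φ β := by
        change x (m β) = m β * (m (-β) * x (m β))
        linear_combination -x (m β) * hmn β
      have h2 : (∑ i, φ (Pi.single i 1) • euler i) (m β) =
          ∑ i, φ (Pi.single i 1) * ((β i : ℂ) • m β) := by
        rw [← Derivation.coeFnAddMonoidHom_apply, map_sum, Finset.sum_apply]
        refine Finset.sum_congr rfl fun i _ => ?_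
        change φ (Pi.single i 1) * euler i (m β) = _
        rw [euler_single]
        simp [m, AddMonoidAlgebra.smul_single]
      rw [h1, h2, hφ, Finset.mul_sum]
      refine Finset.sum_congr rfl fun i _ => ?_
      rw [mul_smul_comm, mul_smul_comm, mul_comm]
  rw [hx]
  exact Submodule.sum_mem _ fun i _ => smul_euler_mem_span i _

end Derivations

section Span

variable {ψ : LPlus →ₗ⁅ℂ⁆ ℂ} {V : Type*} [AddCommGroup V] [Module ℂ V] [Module UL V]
  [IsScalarTower ℂ UL V] {Q : Submodule ℂ V}

/-- The words in the letters of `𝔟⁻` other than `z`, applied to a `z`-stable space of Whittaker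
vectors, span a submodule. -/
theorem smul_mem_wordSpan (hQ : IsWhittakerSpace ψ Q) (u : UL) {v : V}
    (hv : v ∈ wordSpan gen Q fun l => ∀ i ∈ l, i ∈ negLetters) :
    u • v ∈ wordSpan gen Q fun l => ∀ i ∈ l, i ∈ negLetters := by
  classical
  refine smul_mem_of_span_eq_top span_range_d _ ?_ u hv
  rintro _ ⟨k, rfl⟩ v hv
  change gen k • v ∈ _
  refine smul_mem_of_wordSpan _ (fun l hl q hq => ?_) hv
  have hl' : ∀ i ∈ l, i ∈ (fullData ψ).neg := fun i hi => ⟨hl i hi, trivial⟩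
  rcases le_or_gt (toLex k.2) 0 with hk | hk
  · by_cases hz : k = zLetter
    · obtain ⟨q', hq', h⟩ := TriangularData.z_smul_word hQ.full l hl' hq
      change gen zLetter • word gen l • q = word gen l • q' at h
      rw [hz, h]
      exact word_smul_mem _ hl hq'
    · rw [← mul_smul, ← word_cons]
      refine word_smul_mem _ (fun i hi => ?_) hq
      rcases List.mem_cons.mp hi with rfl | hi
      · exact ⟨hk, hz⟩
      · exact hl i hi
  · have h := TriangularData.pos_smul_word (arr := Multiset.toList) Multiset.coe_toList hQ.full l
      hl' hq k ⟨hk, trivial⟩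
    have h' : ∀ δ, wordSpan (fullData ψ).e Q ((fullData ψ).IsLow δ l.length) ≤
      wordSpan gen Q fun l => ∀ i ∈ l, i ∈ negLetters := fun δ => wordSpan_mono fun l hl i hi =>
        (hl.1 i hi).1
    rw [sub_sub] at h
    refine (Submodule.sub_mem_iff_left _ ?_).mp (h' _ h)
    refine Submodule.add_mem _ (Submodule.smul_mem _ _ (word_smul_mem _ hl hq))
      (multiset_sum_mem _ fun v hv => ?_)
    obtain ⟨j, -, rfl⟩ := Multiset.mem_map.mp hv
    refine Submodule.smul_mem _ _ (word_smul_mem gen (fun i hi => ?_) hq)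
    rw [Multiset.mem_toList] at hi
    exact hl i (Multiset.mem_coe.mp (Multiset.mem_of_mem_erase hi))

end Span

section Module

variable (ψ : LPlus →ₗ⁅ℂ⁆ ℂ)

theorem evalZ_smul_mem {V : Type*} [AddCommGroup V] [Module ℂ V] [Module UL V]
    [IsScalarTower ℂ UL V] {S : Submodule ℂ V} (hS : ∀ v ∈ S, gen zLetter • v ∈ S) (f : ℂ[X])
    {v : V} (hv : v ∈ S) : evalZ f • v ∈ S := by
  induction f using Polynomial.induction_on' with
  | add f g hf hg => rw [evalZ, map_add, add_smul]; exact S.add_mem hf hg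
  | monomial n c =>
    rw [evalZ, aeval_monomial, mul_smul, algebraMap_smul]
    refine S.smul_mem c ?_
    induction n with
    | zero => simpa using hv
    | succ n ih => rw [pow_succ', mul_smul]; exact hS _ ih

theorem gen_smul_w {k : Letter} (hk : k ∈ posLetters) :
    gen k • w ψ = psiLetter ψ k • w ψ := by
  have h : ((1 : UL) * envIncl LPlus (UniversalEnvelopingAlgebra.ι ℂ (dPlus k.1 k.2 hk)))
      ⊗ₜ[ℂ] (1 : ℂ) - (1 : UL) ⊗ₜ[ℂ] (UniversalEnvelopingAlgebra.lift ℂ ψ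
        (UniversalEnvelopingAlgebra.ι ℂ (dPlus k.1 k.2 hk)) * 1) ∈ balancing ψ :=
    Submodule.subset_span ⟨_, _, _, rfl⟩
  rw [envIncl, UniversalEnvelopingAlgebra.lift_ι_apply, UniversalEnvelopingAlgebra.lift_ι_apply,
    one_mul, mul_one] at h
  have h' := (Submodule.Quotient.eq _).mpr h
  have h1 : gen k • w ψ = (balancing ψ).mkQ (gen k ⊗ₜ[ℂ] 1) := by
    rw [w, ← map_smul, TensorProduct.smul_tmul', smul_eq_mul, mul_one]
  have h2 : psiLetter ψ k • w ψ = (balancing ψ).mkQ (1 ⊗ₜ[ℂ] ψ (dPlus k.1 k.2 hk)) := by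
    rw [w, show psiLetter ψ k = ψ (dPlus k.1 k.2 hk) from psiLetter_of_pos ψ k.1 hk]
    change _ = Submodule.Quotient.mk _
    rw [Submodule.mkQ_apply, ← Submodule.Quotient.mk_smul, TensorProduct.smul_tmul',
      TensorProduct.smul_tmul, smul_eq_mul, mul_one]
  rw [h1, h2]
  exact h'

/-- The space of the vectors `f(z) w` with `f ∈ I`. -/
noncomputable def idealVectors (I : Ideal ℂ[X]) : Submodule ℂ (W ψ) :=
  (I.restrictScalars ℂ).map
    ((LinearMap.toSpanSingleton UL (W ψ) (w ψ)).restrictScalars ℂ ∘ₗ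
      (aeval (UniversalEnvelopingAlgebra.ι ℂ (d 0 0))).toLinearMap)

variable {ψ}

theorem mem_idealVectors {I : Ideal ℂ[X]} {v : W ψ} :
    v ∈ idealVectors ψ I ↔ ∃ f ∈ I, v = evalZ f • w ψ :=
  ⟨fun ⟨f, hf, h⟩ => ⟨f, hf, h.symm⟩, fun ⟨f, hf, h⟩ => ⟨f, hf, h.symm⟩⟩

theorem evalZ_mul (f g : ℂ[X]) : evalZ (f * g) = evalZ f * evalZ g := map_mul _ f g

theorem isWhittakerSpace_idealVectors (I : Ideal ℂ[X]) :
    IsWhittakerSpace ψ (idealVectors ψ I) where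
  z_mem v hv := by
    obtain ⟨f, hf, rfl⟩ := mem_idealVectors.mp hv
    refine mem_idealVectors.mpr ⟨X * f, I.mul_mem_left X hf, ?_⟩
    rw [evalZ_mul, mul_smul, show evalZ X = gen zLetter from aeval_X _]
  pos_smul k hk v hv := by
    obtain ⟨f, hf, rfl⟩ := mem_idealVectors.mp hv
    let S : Submodule ℂ (W ψ) :=
      { carrier := {v | gen k • v = psiLetter ψ k • v}
        add_mem' := fun {a b} (ha : _ = _) (hb : _ = _) => by
          change _ = _
          rw [smul_add, ha, hb, smul_add]
        zero_mem' := by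
          change _ = _
          rw [smul_zero, smul_zero]
        smul_mem' := fun c a (ha : _ = _) => by
          change _ = _
          rw [smul_comm, ha, smul_comm] }
    refine evalZ_smul_mem (S := S) (fun v (hv : _ = _) => ?_) f (gen_smul_w ψ hk)
    change gen k • gen zLetter • v = psiLetter ψ k • gen zLetter • v
    have h := gen_comm k.1 0 k.2 0
    simp only [Pi.zero_apply, Int.cast_zero, zero_smul, zero_sub, add_zero] at h
    have h' : gen k * gen zLetter = gen zLetter * gen k - (k.2 0 : ℂ) • gen k := by
      rw [sub_eq_add_neg]
      exact sub_eq_iff_eq_add'.mp h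
    have h0 : (k.2 0 : ℂ) * psiLetter ψ k = 0 := by
      by_cases hk0 : psiLetter ψ k = 0
      · rw [hk0, mul_zero]
      · rw [(eq_of_psiLetter_ne_zero ψ (i := k.1) (α := k.2) hk0).1, Int.cast_zero, zero_mul]
    rw [← mul_smul, h', sub_smul, mul_smul, smul_assoc, hv, smul_smul, h0, zero_smul, sub_zero,
      smul_comm]

theorem mem_idealSubmodule_iff {I : Ideal ℂ[X]} {v : W ψ} : v ∈ idealSubmodule ψ I ↔
    v ∈ wordSpan gen (idealVectors ψ I) fun l => ∀ i ∈ l, i ∈ negLetters := by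
  constructor
  · intro hv
    induction hv using Submodule.span_induction with
    | zero => exact Submodule.zero_mem _
    | add v₁ v₂ _ _ h₁ h₂ => exact Submodule.add_mem _ h₁ h₂
    | smul u v _ h => exact smul_mem_wordSpan (isWhittakerSpace_idealVectors I) u h
    | mem v hv =>
      have := word_smul_mem gen (P := fun l => ∀ i ∈ l, i ∈ negLetters) (l := [])
        (by simp) (mem_idealVectors.mpr hv)
      simpa using this
  · intro hv
    have h : wordSpan gen (idealVectors ψ I) (fun l => ∀ i ∈ l, i ∈ negLetters) ≤
        (idealSubmodule ψ I).restrictScalars ℂ := wordSpan_le fun l _ q hq =>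
      (idealSubmodule ψ I).smul_mem _ (Submodule.subset_span (mem_idealVectors.mp hq))
    exact h hv

theorem lieClosed_negLetters (ψ : LPlus →ₗ⁅ℂ⁆ ℂ) :
    LieClosed ℂ gen negLetters (fullData ψ).wt := by
  intro i hi j hj
  have h : {k | k ∈ (fullData ψ).neg ∧ (fullData ψ).wt k = (fullData ψ).wt i + (fullData ψ).wt j} ⊆
      {k | k ∈ negLetters ∧ (fullData ψ).wt k = (fullData ψ).wt i + (fullData ψ).wt j} :=
    fun k hk => ⟨hk.1.1, hk.2⟩
  exact Submodule.span_mono (Set.image_mono h)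
    ((fullData ψ).closed i ⟨hi, trivial⟩ j ⟨hj, trivial⟩)

theorem exists_expand_eq {I : Ideal ℂ[X]} {v : W ψ} (hv : v ∈ idealSubmodule ψ I)
    {arr : Multiset Letter → List Letter} (harr : ∀ m, (arr m : Multiset Letter) = m) :
    ∃ F ∈ coeffs (idealVectors ψ I) fun m => ∀ i ∈ m, i ∈ negLetters,
      expand (𝕜 := ℂ) gen arr F = v :=
  wordSpan_le_map_expand harr (lieClosed_negLetters ψ) _ (mem_idealSubmodule_iff.mp hv)

theorem idealSubmodule_top : idealSubmodule ψ ⊤ = ⊤ := by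
  have hw : w ψ ∈ idealSubmodule ψ ⊤ :=
    Submodule.subset_span ⟨1, Submodule.mem_top, by rw [evalZ, map_one, one_smul]⟩
  refine eq_top_iff.mpr fun v _ => ?_
  obtain ⟨t, rfl⟩ := (balancing ψ).mkQ_surjective v
  induction t using TensorProduct.induction_on with
  | zero => rw [map_zero]; exact Submodule.zero_mem _
  | add t₁ t₂ h₁ h₂ => rw [map_add]; exact Submodule.add_mem _ (h₁ trivial) (h₂ trivial)
  | tmul u c =>
    have : (u ⊗ₜ[ℂ] c : UL ⊗[ℂ] ℂ) = (c • u) • ((1 : UL) ⊗ₜ[ℂ] (1 : ℂ)) := by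
      rw [TensorProduct.smul_tmul', smul_eq_mul, mul_one, TensorProduct.smul_tmul, smul_eq_mul,
        mul_one]
    rw [this, map_smul]
    exact Submodule.smul_mem _ _ hw

/-- The ideal of the polynomials `f` with `f(z) w ∈ M`. -/
def idealOf (M : Submodule UL (W ψ)) : Ideal ℂ[X] where
  carrier := {f | evalZ f • w ψ ∈ M}
  add_mem' {f g} hf hg := by
    change evalZ (f + g) • w ψ ∈ M
    rw [evalZ, map_add, add_smul]
    exact M.add_mem hf hg
  zero_mem' := by
    change evalZ 0 • w ψ ∈ M
    rw [evalZ, map_zero, zero_smul]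
    exact M.zero_mem
  smul_mem' f g hg := by
    change evalZ (f * g) • w ψ ∈ M
    rw [evalZ_mul, mul_smul]
    exact M.smul_mem _ hg

/-- Every submodule is generated by its vectors `f(z) w`: the coefficients of an expansion of
`v ∈ M` lie in `M`, since their images in `W_ψ / M` are the coefficients of an expansion of zero. -/
theorem idealSubmodule_idealOf (hψ : Nonsingular ψ) (M : Submodule UL (W ψ)) :
    idealSubmodule ψ (idealOf M) = M := by
  refine le_antisymm (Submodule.span_le.mpr ?_) fun v hv => ?_
  · rintro _ ⟨f, hf, rfl⟩
    exact hf
  obtain ⟨F, hF, rfl⟩ := exists_expand_eq (I := ⊤) (v := v) (by rw [idealSubmodule_top]; trivial)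
    Multiset.coe_toList
  let π : W ψ →ₗ[ℂ] W ψ ⧸ M := M.mkQ.restrictScalars ℂ
  have hQ := isWhittakerSpace_idealVectors (ψ := ψ) ⊤
  have hQ' : IsWhittakerSpace ψ ((idealVectors ψ ⊤).map π) := by
    constructor
    · rintro _ ⟨q, hq, rfl⟩
      exact ⟨_, hQ.z_mem q hq, map_smul M.mkQ _ _⟩
    · rintro k hk _ ⟨q, hq, rfl⟩
      rw [← map_smul π, ← hQ.pos_smul k hk q hq]
      exact (map_smul M.mkQ _ _).symm
  have hF' : F.mapRange π (map_zero π) = 0 := by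
    refine eq_zero_of_expand_eq_zero (arr := Multiset.toList) Multiset.coe_toList hψ hQ'
      (fun m => ⟨⟨F m, (hF m).1, rfl⟩, fun h => (hF m).2 fun h0 => h ?_⟩) ?_
    · rw [Finsupp.mapRange_apply, h0, map_zero]
    · have h : expand (𝕜 := ℂ) gen Multiset.toList (F.mapRange π (map_zero π)) =
          π (expand (𝕜 := ℂ) gen Multiset.toList F) := by
        rw [expand_apply (V := W ψ), map_sum]
        refine (Finsupp.sum_mapRange_index (by simp)).trans
          (Finset.sum_congr rfl fun m _ => ?_)
        exact (map_smul M.mkQ _ _).symm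
      rw [h]
      exact (Submodule.Quotient.mk_eq_zero M).mpr hv
  rw [expand_apply]
  refine Submodule.sum_mem _ fun m _ => Submodule.smul_mem _ _ (Submodule.subset_span ?_)
  obtain ⟨f, -, hf⟩ := mem_idealVectors.mp (hF m).1
  refine ⟨f, ?_, hf⟩
  change evalZ f • w ψ ∈ M
  rw [← hf]
  exact (Submodule.Quotient.mk_eq_zero M).mp (DFunLike.congr_fun hF' m)

theorem gen_mem_range_envIncl {k : Letter} (hk : toLex k.2 ≤ 0) :
    gen k ∈ (envIncl bMinus).range := by
  refine ⟨UniversalEnvelopingAlgebra.ι ℂ ⟨d k.1 k.2,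
    (Submodule.subset_span ⟨k.1, k.2, hk, rfl⟩ : d k.1 k.2 ∈ gradedSpan {α | toLex α ≤ 0})⟩, ?_⟩
  change envIncl bMinus _ = _
  rw [envIncl, UniversalEnvelopingAlgebra.lift_ι_apply]
  rfl

theorem evalZ_mem_range_envIncl (f : ℂ[X]) : evalZ f ∈ (envIncl bMinus).range := by
  have hz := gen_mem_range_envIncl (k := zLetter) le_rfl
  rw [evalZ, aeval_eq_sum_range]
  exact Subalgebra.sum_mem _ fun n _ => Subalgebra.smul_mem _ (Subalgebra.pow_mem _ hz n) _

/-- The submodule generated by `g(z) w` is already generated by `U(𝔟⁻)`. -/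
theorem idealSubmodule_span_singleton (g : ℂ[X]) :
    (idealSubmodule ψ (Ideal.span {g}) : Set (W ψ)) = bMinusOrbit ψ (evalZ g • w ψ) := by
  refine Set.Subset.antisymm (fun v hv => ?_) ?_
  · let S : Submodule ℂ (W ψ) := (Subalgebra.toSubmodule (envIncl bMinus).range).map
      ((LinearMap.toSpanSingleton UL (W ψ) (evalZ g • w ψ)).restrictScalars ℂ)
    have h : wordSpan gen (idealVectors ψ (Ideal.span {g})) (fun l => ∀ i ∈ l, i ∈ negLetters) ≤
        S := by
      refine wordSpan_le fun l hl q hq => ?_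
      obtain ⟨f, hf, rfl⟩ := mem_idealVectors.mp hq
      obtain ⟨f, rfl⟩ := Ideal.mem_span_singleton'.mp hf
      have hu : word gen l * evalZ f ∈ (envIncl bMinus).range := by
        refine mul_mem (list_prod_mem fun u hu => ?_) (evalZ_mem_range_envIncl f)
        obtain ⟨k, hk, rfl⟩ := List.mem_map.mp hu
        exact gen_mem_range_envIncl (hl k hk).1
      refine ⟨word gen l * evalZ f, hu, ?_⟩
      change (word gen l * evalZ f) • evalZ g • w ψ = _
      rw [evalZ_mul, mul_smul, mul_smul]
    obtain ⟨_, ⟨u, rfl⟩, hu⟩ := h (mem_idealSubmodule_iff.mp hv)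
    exact ⟨u, hu.symm⟩
  · rintro _ ⟨u, rfl⟩
    exact (idealSubmodule ψ _).smul_mem _
      (Submodule.subset_span ⟨g, Ideal.mem_span_singleton_self g, rfl⟩)

end Module

/-! ### Linear independence of arranged words -/

section Independence

variable {𝕜 U ι A : Type*} [Field 𝕜] [Ring U] [Algebra 𝕜 U] [CommRing A] [Algebra 𝕜 A]

theorem derivation_mem_pow (I : Ideal A) (D : Derivation 𝕜 A A) (k : ℕ) {a : A}
    (ha : a ∈ I ^ (k + 1)) : D a ∈ I ^ k := by
  induction k generalizing a with
  | zero => simp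
  | succ k ih =>
    rw [pow_succ'] at ha
    induction ha using Submodule.mul_induction_on' with
    | mem_mul_mem b hb c hc =>
      rw [D.leibniz, smul_eq_mul, smul_eq_mul]
      refine Ideal.add_mem _ ?_ (Ideal.mul_mem_right _ _ hc)
      rw [pow_succ']
      exact Ideal.mul_mem_mul hb (ih hc)
    | add b _ c _ hb hc => rw [map_add]; exact Ideal.add_mem _ hb hc

theorem multiset_prod_mem_pow (I : Ideal A) {φ : ι → A} (hφ : ∀ i, φ i ∈ I) (m : Multiset ι) :
    (m.map φ).prod ∈ I ^ Multiset.card m := by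
  induction m using Multiset.induction with
  | empty => simp
  | cons i m ih =>
    rw [Multiset.map_cons, Multiset.prod_cons, Multiset.card_cons, pow_succ']
    exact Ideal.mul_mem_mul (hφ i) ih

/-- If `φ` are coordinates dual to the derivations `D` modulo the ideal `I`, then `D j` acts on
monomials in `φ` as `∂ⱼ`, up to higher powers of `I`. -/
theorem derivation_multiset_prod [DecidableEq ι] (I : Ideal A) {φ : ι → A} (hφ : ∀ i, φ i ∈ I)
    (D : ι → Derivation 𝕜 A A) (hD : ∀ i j, D j (φ i) - (if i = j then 1 else 0) ∈ I) (j : ι)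
    (m : Multiset ι) :
    D j (m.map φ).prod - (m.count j : A) * ((m.erase j).map φ).prod ∈ I ^ Multiset.card m := by
  induction m using Multiset.induction with
  | empty => simp
  | cons i m ih =>
    rw [Multiset.map_cons, Multiset.prod_cons, Multiset.card_cons, pow_succ', (D j).leibniz,
      smul_eq_mul, smul_eq_mul]
    have h1 := Ideal.mul_mem_mul (hφ i) ih
    have h2 := Ideal.mul_mem_mul (hD i j) (multiset_prod_mem_pow I hφ m)
    have h3 := Ideal.add_mem _ h1 h2
    convert h3 using 1
    by_cases hij : i = j
    · subst hij
      rw [Multiset.count_cons_self, Multiset.erase_cons_head, if_pos rfl]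
      by_cases hi : i ∈ m
      · obtain ⟨m, rfl⟩ := Multiset.exists_cons_of_mem hi
        rw [Multiset.erase_cons_head, Multiset.map_cons, Multiset.prod_cons]
        push_cast
        ring
      · rw [Multiset.count_eq_zero_of_notMem hi]
        push_cast
        ring
    · rw [Multiset.count_cons_of_ne (Ne.symm hij), Multiset.erase_cons_tail _ hij, if_neg hij,
        Multiset.map_cons, Multiset.prod_cons]
      ring

variable {e : ι → U} {ρ : U →ₐ[𝕜] Module.End 𝕜 A} {D : ι → Derivation 𝕜 A A}
  (hρ : ∀ i a, ρ (e i) a = D i a)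

include hρ in
theorem word_mem_pow (I : Ideal A) (l : List ι) (k : ℕ) {a : A} (ha : a ∈ I ^ (l.length + k)) :
    ρ (word e l) a ∈ I ^ k := by
  induction l generalizing k with
  | nil => simpa using ha
  | cons i l ih =>
    rw [word_cons, map_mul, Module.End.mul_apply, hρ]
    refine derivation_mem_pow I _ k (ih (k + 1) ?_)
    rwa [← add_assoc, add_right_comm]

variable {ev : A →ₐ[𝕜] 𝕜} {φ : ι → A} (hφ : ∀ i, ev (φ i) = 0)

include hρ hφ in
/-- A word pairs nontrivially with exactly one monomial in `φ` of the same degree. -/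
theorem exists_ev_word [DecidableEq ι] (hD : ∀ i j, ev (D j (φ i)) = if i = j then 1 else 0)
    (l : List ι) (m : Multiset ι) (hm : Multiset.card m = l.length) :
    ∃ c : ℕ, ev (ρ (word e l) (m.map φ).prod) = c ∧ (c ≠ 0 ↔ (l : Multiset ι) = m) := by
  induction l using List.reverseRecOn generalizing m with
  | nil =>
    obtain rfl := Multiset.card_eq_zero.mp hm
    exact ⟨1, by simp, by simp⟩
  | append_singleton l j ih =>
    rw [List.length_append, List.length_singleton] at hm
    have hI : ∀ i, φ i ∈ RingHom.ker ev := fun i => hφ i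
    have hDI : ∀ i j, D j (φ i) - (if i = j then 1 else 0) ∈ RingHom.ker ev := fun i j => by
      rw [RingHom.mem_ker, map_sub, hD]
      split_ifs <;> simp
    have h1 := derivation_multiset_prod _ hI D hDI j m
    rw [hm] at h1
    have h2 := word_mem_pow hρ _ l 1 h1
    rw [pow_one, RingHom.mem_ker, map_sub, map_sub, sub_eq_zero] at h2
    have h3 : ev (ρ (word e (l ++ [j])) (m.map φ).prod) =
        m.count j * ev (ρ (word e l) ((m.erase j).map φ).prod) := by
      rw [word_append, map_mul, Module.End.mul_apply, word_cons, word_nil, mul_one, hρ, h2,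
        ← nsmul_eq_mul, map_nsmul, map_nsmul, nsmul_eq_mul]
    have h4 : ((l ++ [j] : List ι) : Multiset ι) = j ::ₘ (l : Multiset ι) := by
      rw [← Multiset.coe_add, Multiset.coe_singleton, add_comm, Multiset.singleton_add]
    rw [h3, h4]
    by_cases hj : j ∈ m
    · obtain ⟨m, rfl⟩ := Multiset.exists_cons_of_mem hj
      rw [Multiset.card_cons, add_left_inj] at hm
      rw [Multiset.erase_cons_head, Multiset.cons_inj_right]
      obtain ⟨c, hc, hc'⟩ := ih m hm
      refine ⟨(j ::ₘ m).count j * c, by rw [hc]; push_cast; rfl, ?_⟩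
      rw [← hc', mul_ne_zero_iff]
      exact and_iff_right (Multiset.count_ne_zero.mpr hj)
    · refine ⟨0, by simp [Multiset.count_eq_zero_of_notMem hj], ?_⟩
      simp only [ne_eq, not_true_eq_false, false_iff]
      rintro rfl
      exact hj (Multiset.mem_cons_self _ _)

include hρ hφ in
/-- The independence part of the Poincaré–Birkhoff–Witt theorem, for algebras acting on a
commutative algebra `A` by derivations: arranged words are linearly independent as soon as `A` has
coordinates `φ` at a point `ev` dual to the values of the derivations `D`. -/
theorem linearIndependent_word [CharZero 𝕜] [DecidableEq ι]
    (hD : ∀ i j, ev (D j (φ i)) = if i = j then 1 else 0)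
    {arr : Multiset ι → List ι} (harr : ∀ m, (arr m : Multiset ι) = m) :
    LinearIndependent 𝕜 fun m => word e (arr m) := by
  rw [linearIndependent_iff]
  intro c hc
  by_contra hne
  obtain ⟨m₀, hm₀, hmax⟩ := c.support.exists_max_image Multiset.card
    (Finsupp.support_nonempty_iff.mpr hne)
  have hlen : ∀ m, (arr m).length = Multiset.card m := fun m => by
    rw [← Multiset.coe_card, harr]
  have h := congrArg (fun u => ev (ρ u (m₀.map φ).prod)) hc
  simp only [Finsupp.linearCombination_apply, Finsupp.sum, map_sum, map_smul, map_zero,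
    LinearMap.sum_apply, LinearMap.smul_apply, LinearMap.zero_apply] at h
  rw [Finset.sum_eq_single m₀] at h
  · obtain ⟨a, ha, ha'⟩ := exists_ev_word hρ hφ hD (arr m₀) m₀ (hlen m₀).symm
    rw [ha, smul_eq_mul] at h
    exact mul_ne_zero (Finsupp.mem_support_iff.mp hm₀)
      (Nat.cast_ne_zero.mpr (ha'.mpr (harr m₀))) h
  · intro m hm hmm
    rcases (hmax m hm).lt_or_eq with hlt | heq
    · have h1 := multiset_prod_mem_pow (RingHom.ker ev) (φ := φ) hφ m₀
      obtain ⟨k, hk⟩ := Nat.exists_eq_add_of_lt hlt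
      rw [hk, add_assoc, ← hlen] at h1
      have h2 := Ideal.pow_le_self (Nat.succ_ne_zero k) (word_mem_pow hρ _ _ _ h1)
      rw [RingHom.mem_ker] at h2
      rw [h2, smul_zero]
    · obtain ⟨a, ha, ha'⟩ := exists_ev_word hρ hφ hD (arr m) m₀ (by rw [hlen, heq])
      have ha0 : a = 0 := by
        by_contra h0
        exact hmm ((harr m).symm.trans (ha'.mp h0))
      rw [ha, ha0, Nat.cast_zero, smul_zero]
  · intro h'
    exact absurd hm₀ h'

end Independence

section Matrices

/-- The polynomial functions of the matrix coefficients of an endomorphism of `ℂ[t₁^{±1}, t₂^{±1}]`;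
the variable `(β, γ)` is the coefficient of `t^γ` in the image of `t^β`. -/
abbrev CoeffAlgebra : Type := MvPolynomial (Exponent × Exponent) ℂ

/-- The linear function `a ↦ ∑ δ, a_δ X (δ, γ)`. -/
noncomputable def coeffVar (γ : Exponent) : Laurent →ₗ[ℂ] CoeffAlgebra :=
  Finsupp.linearCombination ℂ (fun δ => (MvPolynomial.X (δ, γ) : CoeffAlgebra)) ∘ₗ
    (AddMonoidAlgebra.coeffLinearEquiv ℂ).toLinearMap

theorem coeffVar_single (γ δ : Exponent) (c : ℂ) :
    coeffVar γ (AddMonoidAlgebra.single δ c) = c • MvPolynomial.X (δ, γ) :=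
  Finsupp.linearCombination_single ..

/-- The derivation by which `x ∈ ℒ` acts on functions of matrix coefficients, through the action on
the first index. -/
noncomputable def coeffDerivation (x : DerL) : Derivation ℂ CoeffAlgebra CoeffAlgebra :=
  MvPolynomial.mkDerivation ℂ fun p => coeffVar p.2 (x (AddMonoidAlgebra.single p.1 1))

theorem coeffDerivation_X (x : DerL) (p : Exponent × Exponent) :
    coeffDerivation x (MvPolynomial.X p) = coeffVar p.2 (x (AddMonoidAlgebra.single p.1 1)) :=
  MvPolynomial.mkDerivation_X ..

theorem coeffDerivation_coeffVar (x : DerL) (γ : Exponent) (a : Laurent) :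
    coeffDerivation x (coeffVar γ a) = coeffVar γ (x a) := by
  induction a using AddMonoidAlgebra.induction_linear with
  | zero => simp only [map_zero]
  | add a b ha hb => simp only [map_add, ha, hb]
  | single δ c =>
    rw [coeffVar_single, Derivation.map_smul, coeffDerivation_X, ← map_smul,
      ← Derivation.map_smul, AddMonoidAlgebra.smul_single, smul_eq_mul, mul_one]

/-- The action of `ℒ` on functions of matrix coefficients. -/
noncomputable def coeffRep : DerL →ₗ⁅ℂ⁆ Module.End ℂ CoeffAlgebra where
  toFun x := (coeffDerivation x : CoeffAlgebra →ₗ[ℂ] CoeffAlgebra)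
  map_add' x y := by
    rw [← Derivation.coe_add_linearMap]
    congr 1
    refine MvPolynomial.derivation_ext fun p => ?_
    rw [Derivation.add_apply, coeffDerivation_X, coeffDerivation_X, coeffDerivation_X,
      Derivation.add_apply, map_add]
  map_smul' c x := by
    rw [RingHom.id_apply, ← Derivation.coe_smul_linearMap]
    congr 1
    refine MvPolynomial.derivation_ext fun p => ?_
    rw [Derivation.smul_apply, coeffDerivation_X, coeffDerivation_X, Derivation.smul_apply,
      map_smul]
  map_lie' {x y} := by
    rw [← Derivation.commutator_coe_linear_map]
    congr 1
    refine MvPolynomial.derivation_ext fun p => ?_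
    rw [Derivation.commutator_apply, coeffDerivation_X, coeffDerivation_X, coeffDerivation_X,
      coeffDerivation_coeffVar, coeffDerivation_coeffVar, Derivation.commutator_apply, map_sub]

/-- Arranged words in the `d i α` are linearly independent in `U(ℒ)`. The coordinate of `d i α` is
the matrix coefficient from `t_i` to `t_i t^α`, at the identity matrix. -/
theorem linearIndependent_word_gen {arr : Multiset Letter → List Letter}
    (harr : ∀ m, (arr m : Multiset Letter) = m) :
    LinearIndependent ℂ fun m => word gen (arr m) := by
  let unit : Fin 2 → Exponent := fun i => Pi.single i 1
  let ev : CoeffAlgebra →ₐ[ℂ] ℂ := MvPolynomial.aeval fun p => if p.1 = p.2 then 1 else 0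
  let φ : Letter → CoeffAlgebra := fun k => MvPolynomial.X (unit k.1, k.2 + unit k.1) -
    MvPolynomial.C (if unit k.1 = k.2 + unit k.1 then 1 else 0)
  refine linearIndependent_word (ρ := UniversalEnvelopingAlgebra.lift ℂ coeffRep)
    (D := fun k => coeffDerivation (d k.1 k.2)) (ev := ev) (φ := φ) (fun k a => ?_) (fun k => ?_)
    (fun k k' => ?_) harr
  · rw [gen, UniversalEnvelopingAlgebra.lift_ι_apply]
    rfl
  · rw [map_sub, MvPolynomial.aeval_X, MvPolynomial.aeval_C]
    simp
  · rw [map_sub, MvPolynomial.derivation_C, sub_zero, coeffDerivation_X, d_apply_single,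
      coeffVar_single, map_smul, MvPolynomial.aeval_X, mul_one]
    obtain ⟨i, α⟩ := k
    obtain ⟨j, β⟩ := k'
    by_cases hij : i = j
    · subst hij
      simp [unit, eq_comm]
    · simp [unit, hij, Ne.symm hij]

end Matrices

/-! ### A functional on the universal Whittaker module -/

/-- The spanning part of the Poincaré–Birkhoff–Witt theorem. -/
theorem span_word_eq_top {ι Γ L : Type*} [AddCommGroup Γ] [LieRing L] [LieAlgebra ℂ L]
    {N : Set ι} {wt : ι → Γ} {x : ι → L} (hx : Submodule.span ℂ (x '' N) = ⊤)
    (hN : LieClosed ℂ (fun k => UniversalEnvelopingAlgebra.ι ℂ (x k)) N wt)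
    {arr : Multiset ι → List ι} (harr : ∀ m, (arr m : Multiset ι) = m) :
    Submodule.span ℂ {u | ∃ m : Multiset ι, (∀ i ∈ m, i ∈ N) ∧
      u = word (fun k => UniversalEnvelopingAlgebra.ι ℂ (x k)) (arr m)} = ⊤ := by
  let e : ι → UniversalEnvelopingAlgebra ℂ L := fun k => UniversalEnvelopingAlgebra.ι ℂ (x k)
  let Q : Submodule ℂ (UniversalEnvelopingAlgebra ℂ L) := Submodule.span ℂ {1}
  have h1 : (1 : UniversalEnvelopingAlgebra ℂ L) ∈ wordSpan e Q fun l => ∀ i ∈ l, i ∈ N := by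
    have := word_smul_mem e (Q := Q) (P := fun l => ∀ i ∈ l, i ∈ N) (l := []) (by simp)
      (Submodule.mem_span_singleton_self 1)
    simpa using this
  refine eq_top_iff.mpr fun u _ => ?_
  have h2 : u ∈ wordSpan e Q fun l => ∀ i ∈ l, i ∈ N := by
    have := smul_mem_of_span_eq_top hx (wordSpan e Q fun l => ∀ i ∈ l, i ∈ N) ?_ u h1
    · simpa using this
    · rintro _ ⟨k, hk, rfl⟩ v hv
      refine smul_mem_of_wordSpan _ (fun l hl q hq => ?_) hv
      rw [← mul_smul]
      refine word_smul_mem e (l := k :: l) (fun i hi => ?_) hq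
      rcases List.mem_cons.mp hi with rfl | hi
      · exact hk
      · exact hl i hi
  obtain ⟨F, hF, rfl⟩ := wordSpan_le_map_expand harr hN Q h2
  rw [expand_apply]
  refine Submodule.sum_mem _ fun m hm => ?_
  obtain ⟨c, hc⟩ := Submodule.mem_span_singleton.mp (hF m).1
  rw [← hc, smul_comm, smul_eq_mul, mul_one]
  exact Submodule.smul_mem _ _ (Submodule.subset_span
    ⟨m, (hF m).2 (Finsupp.mem_support_iff.mp hm), rfl⟩)

theorem lieClosed_univ : LieClosed ℂ gen Set.univ fun k => k.2 := by
  rintro ⟨i, α⟩ - ⟨j, β⟩ -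
  rw [gen_comm]
  exact Submodule.sub_mem _
    (Submodule.smul_mem _ _ (Submodule.subset_span ⟨_, ⟨trivial, rfl⟩, rfl⟩))
    (Submodule.smul_mem _ _ (Submodule.subset_span ⟨_, ⟨trivial, rfl⟩, rfl⟩))

open Classical in
/-- The basis vector `d i α` of `ℒ⁺` for a letter of `ℒ⁺`, and zero for the other letters. -/
noncomputable def posVector (k : Letter) : LPlus :=
  if h : 0 < toLex k.2 then dPlus k.1 k.2 h else 0

theorem posVector_of_pos (i : Fin 2) {α : Exponent} (h : 0 < toLex α) :
    posVector (i, α) = dPlus i α h := dif_pos h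

theorem coe_posVector {k : Letter} (hk : k ∈ posLetters) : (posVector k : DerL) = d k.1 k.2 :=
  congrArg Subtype.val (posVector_of_pos k.1 hk)

theorem span_posVector : Submodule.span ℂ (posVector '' posLetters) = ⊤ := by
  refine eq_top_iff.mpr fun x _ => ?_
  obtain ⟨x, hx⟩ := x
  have hx' : x ∈ gradedSpan {α | 0 < toLex α} := hx
  have key : ∃ y ∈ Submodule.span ℂ (posVector '' posLetters), (y : DerL) = x := by
    clear * - hx'
    induction hx' using Submodule.span_induction with
    | zero => exact ⟨0, Submodule.zero_mem _, rfl⟩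
    | add x₁ x₂ _ _ h₁ h₂ =>
      obtain ⟨y₁, hy₁, rfl⟩ := h₁
      obtain ⟨y₂, hy₂, rfl⟩ := h₂
      exact ⟨y₁ + y₂, Submodule.add_mem _ hy₁ hy₂, rfl⟩
    | smul c x _ h =>
      obtain ⟨y, hy, rfl⟩ := h
      exact ⟨c • y, Submodule.smul_mem _ c hy, rfl⟩
    | mem x hx =>
      obtain ⟨i, α, hα, rfl⟩ := hx
      exact ⟨posVector (i, α), Submodule.subset_span ⟨(i, α), hα, rfl⟩, coe_posVector hα⟩
  obtain ⟨y, hy, rfl⟩ := key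
  exact hy

theorem lieClosed_posLetters :
    LieClosed ℂ (fun k => UniversalEnvelopingAlgebra.ι ℂ (posVector k)) posLetters
      fun k => k.2 := by
  rintro ⟨i, α⟩ hα ⟨j, β⟩ hβ
  have hαβ : ∀ i : Fin 2, (i, α + β) ∈ posLetters := fun _ => add_pos (α := Lex Exponent) hα hβ
  have h : ⁅posVector (i, α), posVector (j, β)⁆ =
      (β i : ℂ) • posVector (j, α + β) - (α j : ℂ) • posVector (i, α + β) := by
    refine Subtype.ext ?_
    rw [LieSubalgebra.coe_bracket, AddSubgroupClass.coe_sub, SetLike.val_smul, SetLike.val_smul,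
      coe_posVector hα, coe_posVector hβ, coe_posVector (hαβ _),
      coe_posVector (hαβ _), bracket_d]
  have h' := (UniversalEnvelopingAlgebra.ι ℂ).map_lie (posVector (i, α)) (posVector (j, β))
  rw [LieRing.of_associative_ring_bracket] at h'
  rw [← h', h, map_sub, map_smul, map_smul]
  exact Submodule.sub_mem _
    (Submodule.smul_mem _ _ (Submodule.subset_span ⟨_, ⟨hαβ j, rfl⟩, rfl⟩))
    (Submodule.smul_mem _ _ (Submodule.subset_span ⟨_, ⟨hαβ i, rfl⟩, rfl⟩))

open Classical in
/-- The arrangement of letters that puts those of `ℒ⁺` last, preceded by the powers of `z`. -/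
noncomputable def triangularArr (m : Multiset Letter) : List Letter :=
  (m.filter fun k => k ∈ negLetters).toList ++ (m.filter fun k => k = zLetter).toList ++
    (m.filter fun k => k ∈ posLetters).toList

theorem notMem_posLetters_of_neg {k : Letter} (hk : k ∈ negLetters) : k ∉ posLetters :=
  fun h => absurd (show 0 < toLex k.2 from h) hk.1.not_gt

theorem zLetter_notMem_posLetters : zLetter ∉ posLetters := fun h =>
  lt_irrefl (0 : Lex Exponent) h

theorem coe_triangularArr (m : Multiset Letter) : (triangularArr m : Multiset Letter) = m := by
  classical
  rw [triangularArr, ← Multiset.coe_add, ← Multiset.coe_add, Multiset.coe_toList,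
    Multiset.coe_toList, Multiset.coe_toList]
  have h1 : m.filter (fun k => k ∈ negLetters) + m.filter (fun k => k = zLetter) =
      m.filter fun k => k ∉ posLetters := by
    rw [Multiset.filter_add_filter]
    have h2 : m.filter (fun k => k ∈ negLetters ∧ k = zLetter) = 0 :=
      Multiset.filter_eq_nil.mpr fun k _ hk => hk.1.2 hk.2
    rw [h2, add_zero]
    refine Multiset.filter_congr fun k _ => ⟨?_, fun h => ?_⟩
    · rintro (h | rfl)
      · exact notMem_posLetters_of_neg h
      · exact zLetter_notMem_posLetters
    · by_cases hz : k = zLetter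
      · exact Or.inr hz
      · exact Or.inl ⟨not_lt.mp h, hz⟩
  rw [h1, add_comm]
  exact Multiset.filter_add_not _ _

theorem triangularArr_add_pos {a p : Multiset Letter} (ha : ∀ k ∈ a, k ∉ posLetters)
    (hp : ∀ k ∈ p, k ∈ posLetters) :
    triangularArr (a + p) = triangularArr a ++ triangularArr p := by
  classical
  have h1 : p.filter (fun k => k ∈ negLetters) = 0 :=
    Multiset.filter_eq_nil.mpr fun k hk h => notMem_posLetters_of_neg h (hp k hk)
  have h2 : p.filter (fun k => k = zLetter) = 0 :=
    Multiset.filter_eq_nil.mpr fun k hk h => zLetter_notMem_posLetters (h ▸ hp k hk)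
  have h3 : a.filter (fun k => k ∈ posLetters) = 0 := Multiset.filter_eq_nil.mpr ha
  simp only [triangularArr, Multiset.filter_add, h1, h2, h3, add_zero, zero_add,
    Multiset.toList_zero, List.append_nil, List.nil_append]

theorem triangularArr_add_z {a : Multiset Letter} (ha : ∀ k ∈ a, k ∈ negLetters) (n : ℕ) :
    triangularArr (a + Multiset.replicate n zLetter) =
      triangularArr a ++ List.replicate n zLetter := by
  classical
  have h1 : (Multiset.replicate n zLetter).filter (fun k => k ∈ negLetters) = 0 :=
    Multiset.filter_eq_nil.mpr fun k hk h => h.2 (Multiset.eq_of_mem_replicate hk)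
  have h2 : a.filter (fun k => k = zLetter) = 0 :=
    Multiset.filter_eq_nil.mpr fun k hk h => (ha k hk).2 h
  have h3 : a.filter (fun k => k ∈ posLetters) = 0 :=
    Multiset.filter_eq_nil.mpr fun k hk => notMem_posLetters_of_neg (ha k hk)
  have h4 : (Multiset.replicate n zLetter).filter (fun k => k ∈ posLetters) = 0 :=
    Multiset.filter_eq_nil.mpr fun k hk h =>
      zLetter_notMem_posLetters ((Multiset.eq_of_mem_replicate hk).symm ▸ h)
  have h5 : (Multiset.replicate n zLetter).filter (fun k => k = zLetter) =
      Multiset.replicate n zLetter :=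
    Multiset.filter_eq_self.mpr fun k hk => Multiset.eq_of_mem_replicate hk
  have h6 : (Multiset.replicate n zLetter).toList = List.replicate n zLetter :=
    List.eq_replicate_iff.mpr ⟨by simp, fun k hk =>
      Multiset.eq_of_mem_replicate (Multiset.mem_toList.mp hk)⟩
  simp only [triangularArr, Multiset.filter_add, h1, h2, h3, h4, h5, h6, add_zero, zero_add,
    Multiset.toList_zero, List.append_nil]

section Functional

variable (ψ : LPlus →ₗ⁅ℂ⁆ ℂ)

open Classical in
/-- The values of the functional on `U(ℒ)` on letters: `ψ` on `ℒ⁺`, the variable at `z`, and zero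
on the remaining letters of `𝔟⁻`. -/
noncomputable def letterValue (k : Letter) : ℂ[X] :=
  if k ∈ posLetters then C (psiLetter ψ k) else if k = zLetter then X else 0

theorem exists_functional : ∃ P : UL →ₗ[ℂ] ℂ[X],
    ∀ m, P (word gen (triangularArr m)) = (m.map (letterValue ψ)).prod := by
  have hli := linearIndependent_word_gen coe_triangularArr
  obtain ⟨g, hg⟩ := LinearMap.exists_leftInverse_of_injective _
    (LinearMap.ker_eq_bot.mpr hli)
  refine ⟨Finsupp.linearCombination ℂ (fun m => (m.map (letterValue ψ)).prod) ∘ₗ g, fun m => ?_⟩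
  have h := DFunLike.congr_fun hg (Finsupp.single m 1)
  rw [LinearMap.comp_apply, Finsupp.linearCombination_single, one_smul, LinearMap.id_apply] at h
  rw [LinearMap.comp_apply, h, Finsupp.linearCombination_single, one_smul]

/-- The functional on `U(ℒ)` with values in `ℂ[z]` that is multiplicative on arranged words. Its
existence is where linear independence of the arranged words is used. -/
noncomputable def functional : UL →ₗ[ℂ] ℂ[X] := (exists_functional ψ).choose

theorem functional_word (m : Multiset Letter) :
    functional ψ (word gen (triangularArr m)) = (m.map (letterValue ψ)).prod :=
  (exists_functional ψ).choose_spec m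

theorem envIncl_word {p : Multiset Letter} (hp : ∀ k ∈ p, k ∈ posLetters) :
    envIncl LPlus (word (fun k => UniversalEnvelopingAlgebra.ι ℂ (posVector k))
      (triangularArr p)) = word gen (triangularArr p) := by
  rw [word, map_list_prod, List.map_map, word]
  congr 1
  refine List.map_congr_left fun k hk => ?_
  rw [← Multiset.mem_coe, coe_triangularArr] at hk
  rw [Function.comp_apply, envIncl, UniversalEnvelopingAlgebra.lift_ι_apply, LieHom.comp_apply,
    gen, ← coe_posVector (hp k hk)]
  rfl

theorem lift_word {p : Multiset Letter} (hp : ∀ k ∈ p, k ∈ posLetters) :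
    C (UniversalEnvelopingAlgebra.lift ℂ ψ
      (word (fun k => UniversalEnvelopingAlgebra.ι ℂ (posVector k)) (triangularArr p))) =
      (p.map (letterValue ψ)).prod := by
  rw [word, map_list_prod, List.map_map, map_list_prod, List.map_map]
  conv_rhs => rw [← coe_triangularArr p, Multiset.map_coe, Multiset.prod_coe]
  congr 1
  refine List.map_congr_left fun k hk => ?_
  rw [← Multiset.mem_coe, coe_triangularArr] at hk
  rw [Function.comp_apply, Function.comp_apply, UniversalEnvelopingAlgebra.lift_ι_apply,
    letterValue, if_pos (hp k hk), posVector_of_pos k.1 (hp k hk),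
    ← psiLetter_of_pos ψ k.1 (hp k hk)]

theorem functional_word_mul_envIncl {a : Multiset Letter} (ha : ∀ k ∈ a, k ∉ posLetters)
    (s : UniversalEnvelopingAlgebra ℂ LPlus) :
    functional ψ (word gen (triangularArr a) * envIncl LPlus s) =
      (a.map (letterValue ψ)).prod * C (UniversalEnvelopingAlgebra.lift ℂ ψ s) := by
  have hs := span_word_eq_top span_posVector lieClosed_posLetters coe_triangularArr ▸
    Submodule.mem_top (x := s)
  induction hs using Submodule.span_induction with
  | zero => simp
  | add s₁ s₂ _ _ h₁ h₂ => rw [map_add, mul_add, map_add, h₁, h₂, map_add, C_add, mul_add]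
  | smul c s _ h =>
    rw [map_smul, mul_smul_comm, map_smul, h, map_smul, smul_eq_mul, C_mul, smul_eq_C_mul]
    ring
  | mem s hs =>
    obtain ⟨p, hp, rfl⟩ := hs
    rw [envIncl_word hp, lift_word ψ hp, ← word_append, ← triangularArr_add_pos ha hp,
      functional_word, Multiset.map_add, Multiset.prod_add]

/-- The functional is equivariant for right multiplication by `U(ℒ⁺)`. -/
theorem functional_mul_envIncl (u : UL) (s : UniversalEnvelopingAlgebra ℂ LPlus) :
    functional ψ (u * envIncl LPlus s) =
      functional ψ u * C (UniversalEnvelopingAlgebra.lift ℂ ψ s) := by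
  have hu := span_word_eq_top (x := fun k : Letter => d k.1 k.2) (N := Set.univ)
    (by rw [Set.image_univ]; exact span_range_d) lieClosed_univ coe_triangularArr ▸
    Submodule.mem_top (x := u)
  induction hu using Submodule.span_induction with
  | zero => simp
  | add u₁ u₂ _ _ h₁ h₂ => rw [add_mul, map_add, h₁, h₂, map_add, add_mul]
  | smul c u _ h => rw [smul_mul_assoc, map_smul, h, map_smul, smul_mul_assoc]
  | mem u hu =>
    classical
    obtain ⟨m, -, rfl⟩ := hu
    change functional ψ (word gen (triangularArr m) * _) =
      functional ψ (word gen (triangularArr m)) * _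
    have hm : m.filter (fun k => k ∉ posLetters) + m.filter (fun k => k ∈ posLetters) = m := by
      rw [add_comm]
      exact Multiset.filter_add_not _ _
    have ha : ∀ k ∈ m.filter (fun k => k ∉ posLetters), k ∉ posLetters := fun k hk =>
      (Multiset.mem_filter.mp hk).2
    have hp : ∀ k ∈ m.filter (fun k => k ∈ posLetters), k ∈ posLetters := fun k hk =>
      (Multiset.mem_filter.mp hk).2
    rw [← hm, triangularArr_add_pos ha hp, word_append, ← envIncl_word hp, mul_assoc, ← map_mul,
      functional_word_mul_envIncl ψ ha, functional_word_mul_envIncl ψ ha, map_mul, C_mul, mul_assoc]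

theorem functional_word_mul_evalZ {a : Multiset Letter} (ha : ∀ k ∈ a, k ∈ negLetters) (f : ℂ[X]) :
    functional ψ (word gen (triangularArr a) * evalZ f) = (a.map (letterValue ψ)).prod * f := by
  induction f using Polynomial.induction_on' with
  | add f g hf hg => rw [evalZ, map_add, mul_add, map_add, mul_add, ← hf, ← hg]; rfl
  | monomial n c =>
    have h1 : evalZ (monomial n c) = c • word gen (List.replicate n zLetter) := by
      rw [evalZ, aeval_monomial, ← Algebra.smul_def, word, List.map_replicate, List.prod_replicate]
      rfl
    have h2 : letterValue ψ zLetter = X := by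
      rw [letterValue, if_neg zLetter_notMem_posLetters, if_pos rfl]
    rw [h1, mul_smul_comm, map_smul, ← word_append, ← triangularArr_add_z ha, functional_word,
      Multiset.map_add, Multiset.prod_add, Multiset.map_replicate, Multiset.prod_replicate, h2,
      ← C_mul_X_pow_eq_monomial, smul_eq_C_mul]
    ring

/-- The functional descends to `W_ψ`. -/
theorem functional_eq_zero_of_mem_balancing {u : UL} (hu : u ⊗ₜ[ℂ] (1 : ℂ) ∈ balancing ψ) :
    functional ψ u = 0 := by
  have key : ∀ t ∈ balancing ψ, ∀ u : UL,
      functional ψ (u * TensorProduct.AlgebraTensorModule.rid ℂ UL UL t) = 0 := by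
    intro t ht
    induction ht using Submodule.span_induction with
    | zero => simp
    | add t₁ t₂ _ _ h₁ h₂ => intro u; rw [map_add, mul_add, map_add, h₁, h₂, add_zero]
    | smul v t _ h => intro u; rw [map_smul, smul_eq_mul, ← mul_assoc, h]
    | mem t ht =>
      obtain ⟨v, s, c, rfl⟩ := ht
      intro u
      rw [map_sub, TensorProduct.AlgebraTensorModule.rid_tmul,
        TensorProduct.AlgebraTensorModule.rid_tmul, mul_sub, mul_smul_comm, mul_smul_comm, map_sub,
        map_smul, map_smul, ← mul_assoc, functional_mul_envIncl, smul_eq_C_mul, smul_eq_C_mul,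
        C_mul]
      ring
  have h := key _ hu 1
  rwa [TensorProduct.AlgebraTensorModule.rid_tmul, one_smul, one_mul] at h

end Functional

section Lattice

variable {ψ : LPlus →ₗ⁅ℂ⁆ ℂ}

/-- The vectors `f(z) w` in `M(I)` are those with `f ∈ I`. -/
theorem idealOf_idealSubmodule (I : Ideal ℂ[X]) : idealOf (idealSubmodule ψ I) = I := by
  refine le_antisymm (fun f hf => ?_) fun f hf => Submodule.subset_span ⟨f, hf, rfl⟩
  obtain ⟨F, hF, hv⟩ := exists_expand_eq (v := evalZ f • w ψ) hf coe_triangularArr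
  choose g hg hFg using fun m => mem_idealVectors.mp (hF m).1
  have hneg : ∀ m ∈ F.support, ∀ k ∈ m, k ∈ negLetters := fun m hm =>
    (hF m).2 (Finsupp.mem_support_iff.mp hm)
  let u : UL := evalZ f - ∑ m ∈ F.support, word gen (triangularArr m) * evalZ (g m)
  have hu : u • w ψ = 0 := by
    rw [sub_smul, ← hv, expand_apply, Finset.sum_smul, sub_eq_zero]
    refine Finset.sum_congr rfl fun m _ => ?_
    rw [mul_smul, ← hFg]
  have hu' : u ⊗ₜ[ℂ] (1 : ℂ) ∈ balancing ψ := by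
    rw [← Submodule.Quotient.mk_eq_zero, ← Submodule.mkQ_apply, ← hu, w, ← map_smul,
      TensorProduct.smul_tmul', smul_eq_mul, mul_one]
  have h0 := functional_eq_zero_of_mem_balancing ψ hu'
  have h1 : functional ψ (evalZ f) = f := by
    have h := functional_word_mul_evalZ ψ (a := 0) (by simp) f
    have h2 : triangularArr 0 = [] := by rw [← Multiset.coe_eq_zero, coe_triangularArr]
    rwa [h2, word_nil, one_mul, Multiset.map_zero, Multiset.prod_zero, one_mul] at h
  rw [map_sub, map_sum, h1, sub_eq_zero] at h0
  rw [h0]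
  refine I.sum_mem fun m hm => ?_
  rw [functional_word_mul_evalZ ψ (hneg m hm)]
  exact I.mul_mem_left _ (hg m)

/-- The lattice of ideals of `ℂ[z]` is the lattice of submodules of `W_ψ`. -/
noncomputable def idealOrderIso (hψ : Nonsingular ψ) : Ideal ℂ[X] ≃o Submodule UL (W ψ) where
  toFun := idealSubmodule ψ
  invFun := idealOf
  left_inv := idealOf_idealSubmodule
  right_inv := idealSubmodule_idealOf hψ
  map_rel_iff' {I J} := by
    change idealSubmodule ψ I ≤ idealSubmodule ψ J ↔ I ≤ J
    refine ⟨fun h => ?_, fun h => Submodule.span_mono fun v ⟨f, hf, hv⟩ => ⟨f, h hf, hv⟩⟩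
    rw [← idealOf_idealSubmodule (ψ := ψ) I, ← idealOf_idealSubmodule (ψ := ψ) J]
    exact fun f hf => h hf

end Lattice

end TorusWhittaker

/-- Submodules of `W_ψ` are its `U(ℒ)`-submodules; maximal submodules are the coatoms of the lattice
of submodules. -/
theorem theorem4p2 (ψ : TorusWhittaker.LPlus →ₗ⁅ℂ⁆ ℂ) (hψ : TorusWhittaker.Nonsingular ψ) :
    (∀ M : Submodule TorusWhittaker.UL (TorusWhittaker.W ψ), ∃ g : ℂ[X],
      (M : Set (TorusWhittaker.W ψ)) =
        TorusWhittaker.bMinusOrbit ψ (TorusWhittaker.evalZ g • TorusWhittaker.w ψ)) ∧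
    (∀ g : ℂ[X], (TorusWhittaker.idealSubmodule ψ (Ideal.span {g}) : Set (TorusWhittaker.W ψ)) =
        TorusWhittaker.bMinusOrbit ψ (TorusWhittaker.evalZ g • TorusWhittaker.w ψ)) ∧
    Function.Bijective (TorusWhittaker.idealSubmodule ψ) ∧
    Set.BijOn (TorusWhittaker.idealSubmodule ψ)
      {I : Ideal ℂ[X] | I.IsMaximal}
      {M : Submodule TorusWhittaker.UL (TorusWhittaker.W ψ) | IsCoatom M} := by
  let Φ := TorusWhittaker.idealOrderIso hψ
  refine ⟨fun M => ?_, TorusWhittaker.idealSubmodule_span_singleton, Φ.bijective, ?_⟩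
  · obtain ⟨g, hg⟩ := (IsPrincipalIdealRing.principal (TorusWhittaker.idealOf M)).principal
    refine ⟨g, ?_⟩
    rw [← TorusWhittaker.idealSubmodule_span_singleton, Ideal.span, ← hg,
      TorusWhittaker.idealSubmodule_idealOf hψ]
  · refine ⟨fun I hI => (Φ.isCoatom_iff I).mpr (Ideal.isMaximal_def.mp hI), Φ.injective.injOn,
      fun M hM => ⟨Φ.symm M, ?_, Φ.apply_symm_apply M⟩⟩
    exact Ideal.isMaximal_def.mpr ((Φ.symm.isCoatom_iff M).mpr hM)
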